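/- Let $D$ be a set (for instance a subset of $\mathbb R^d$) with a $\sigma$-algebra and a probability measure $\varrho_D$, and let $H(K)$ be a reproducing kernel Hilbert space of complex-valued functions on $D$ that is compactly embedded into $L_2(D,\varrho_D)$, with embedding $\mathrm{Id}\colon H(K)\to L_2(D,\varrho_D)$. Let $\lambda_1\ge\lambda_2\ge\dots>0$ be the positive eigenvalues of $W=\mathrm{Id}^*\circ\mathrm{Id}$, counted with multiplicity, with $H(K)$-orthonormal eigenvectors $e_1,e_2,\dots$ (if there are only finitely many, put $\lambda_j=0$ for the remaining $j$), and let $\sigma_j=\sqrt{\lambda_j}$ and, if $\lambda_j>0$, $\eta_j=\lambda_j^{-1/2}e_j$. Let $m,n\in\mathbb N$, $m\ge 2$, $\lambda_{m-1}>0$, and $0<\delta<1$ be such that $$N(m):=\sup_{x\in D}\sum_{k=1}^{m-1}|\eta_k(x)|^2\le\frac{n}{48(\sqrt2\,\log(2n)-\log\delta)} .$$ Let $f\in H(K)$ be fixed with $\|f\|_{H(K)}\le 1$. Draw $\mathbf X=(x^1,\dots,x^n)$ with $x^1,\dots,x^n$ i.i.d. according to $\varrho_D$, and put $\mathbf L_m=(\eta_k(x^i))_{1\le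 i\le n,\,1\le k\le m-1}$, $\mathbf H_m=\frac1n\mathbf L_m^*\mathbf L_m$, and $S^m_{\mathbf X}f=\sum_{k=1}^{m-1}c_k\eta_k$ with the least squares coefficients $(c_1,\dots,c_{m-1})^\top=(\mathbf L_m^*\mathbf L_m)^{-1}\mathbf L_m^*(f(x^1),\dots,f(x^n))^\top$, defined if $\mathbf L_m$ has full column rank. Let $\|\cdot\|$ be the spectral norm of matrices and $\mathbf I_m$ the identity matrix of size $m-1$. (a) The event $\|\mathbf H_m-\mathbf I_m\|\le\frac12$ is measurable (up to null sets) and has positive probability, the squared error is integrable on it, and $$\mathbb E\Big(\|f-S^m_{\mathbf X}f\|^2_{L_2(D,\varrho_D)}\,\Big|\,\|\mathbf H_m-\mathbf I_m\|\le\tfrac12\Big)\le\frac1{1-\delta}\Big(\sigma_m^2+\frac{C_\delta}{\log n}\sigma_m^2\Big)\le\frac{1.1}{1-\delta}\,\sigma_m^2 ,$$ where $0<C_\delta\le 0.06$ depends only on $\delta$. (b) The event that $\mathbf L_m$ has full column rank and $$\|f-S^m_{\mathbf X}f\|^2_{L_2(D,\varrho_D)}\le\frac1\delta\,\sigma_m^2\Big(1+\frac{0.06}{\log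 n}\Big)$$ is measurable (up to null sets) and has probability at least $1-3\delta$. -/

import Mathlib

open MeasureTheory ProbabilityTheory
open scoped ENNReal Matrix

noncomputable section

namespace LSRecovery

section Embedding

variable {D : Type*} [MeasurableSpace D] (ρ : Measure D)
variable {H : Type*} [NormedAddCommGroup H] [InnerProductSpace ℂ H] [RKHS ℂ H D ℂ]

/-- The embedding `H(K) → L₂(D, ρ)`, sending a function to its class modulo `ρ`-a.e. equality
(so it need not be injective). -/
def embedding (hL2 : ∀ f : H, MemLp (f : D → ℂ) 2 ρ) : H →ₗ[ℂ] Lp ℂ 2 ρ where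
  toFun f := (hL2 f).toLp f
  map_add' f g := by
    rw [← MemLp.toLp_add]
    exact MemLp.toLp_congr _ _ (by simp)
  map_smul' c f := by
    rw [RingHom.id_apply, ← MemLp.toLp_const_smul]
    exact MemLp.toLp_congr _ _ (by simp)

variable (H) in
/-- `H` is compactly embedded into `L₂(D, ρ)`: all its members are square integrable and the
embedding is a compact operator. -/
structure CompactlyEmbedded : Prop where
  memLp : ∀ f : H, MemLp (f : D → ℂ) 2 ρ
  compact : IsCompactOperator (embedding ρ memLp)

variable {ρ}

/-- The embedding as a bounded operator `Id : H(K) → L₂(D, ρ)`. -/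
def CompactlyEmbedded.Id (h : CompactlyEmbedded ρ H) : H →L[ℂ] Lp ℂ 2 ρ :=
  ⟨embedding ρ h.memLp, h.compact.continuous⟩

/-- The operator `W = Id* ∘ Id : H(K) → H(K)`. -/
def CompactlyEmbedded.W [CompleteSpace H] (h : CompactlyEmbedded ρ H) : H →L[ℂ] H :=
  ContinuousLinearMap.adjoint h.Id ∘L h.Id

end Embedding

/-- `(lam j, e j)`, `j = 0, 1, 2, …`, enumerates the eigenpairs of `W` with positive eigenvalue,
in non-increasing order and counted with multiplicity, the eigenvectors being orthonormal.
If there are only finitely many of them, then `lam` is continued by zeros (and nothing is asked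
of the corresponding `e j`). -/
structure IsEigensystem {H : Type*} [NormedAddCommGroup H] [InnerProductSpace ℂ H]
    (W : H →L[ℂ] H) (lam : ℕ → ℝ) (e : ℕ → H) : Prop where
  nonneg : ∀ j, 0 ≤ lam j
  antitone : Antitone lam
  orthonormal : Orthonormal ℂ (fun j : {j : ℕ // 0 < lam j} => e j)
  eigen : ∀ j, 0 < lam j → W (e j) = (lam j : ℂ) • e j
  /-- every eigenvector with a positive eigenvalue is accounted for -/
  exhaustive : ∀ (t : ℝ) (g : H), 0 < t → W g = (t : ℂ) • g →
    g ∈ Submodule.span ℂ (e '' {j | lam j = t})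

/-- The singular number `σ_m = √λ_m`, `m = 1, 2, …` (`lam` is indexed from `0`). -/
def sigma (lam : ℕ → ℝ) (m : ℕ) : ℝ := Real.sqrt (lam (m - 1))

section Algorithm

variable {D : Type*} {H : Type*} [NormedAddCommGroup H] [InnerProductSpace ℂ H] [RKHS ℂ H D ℂ]
variable (lam : ℕ → ℝ) (e : ℕ → H)

/-- The system `η_k = λ_k^{-1/2} e_k`, orthonormal in `L₂` (indexed from `0`). -/
def eta (k : ℕ) : H := (((Real.sqrt (lam k))⁻¹ : ℝ) : ℂ) • e k

/-- The spectral function `N(m) = sup_x ∑_{k=1}^{m-1} |η_k(x)|²`, possibly infinite. -/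
def spectralFun (m : ℕ) : ℝ≥0∞ :=
  ⨆ x : D, ∑ k ∈ Finset.range (m - 1), ENNReal.ofReal (‖eta lam e k x‖ ^ 2)

/-- The `n × (m-1)` matrix `L_m(X)` with entries `η_k(xⁱ)`. -/
def sampleMatrix (m : ℕ) {n : ℕ} (X : Fin n → D) : Matrix (Fin n) (Fin (m - 1)) ℂ :=
  Matrix.of fun i k => eta lam e k (X i)

/-- `H_m(X) = (1/n) L_m(X)* L_m(X)`. -/
def gramMatrix (m : ℕ) {n : ℕ} (X : Fin n → D) : Matrix (Fin (m - 1)) (Fin (m - 1)) ℂ :=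
  (1 / n : ℂ) • ((sampleMatrix lam e m X)ᴴ * sampleMatrix lam e m X)

/-- The event `‖H_m - I_m‖ ≤ 1/2`, with the spectral norm. -/
def goodEvent (m n : ℕ) : Set (Fin n → D) :=
  {X | ‖Matrix.toEuclideanCLM (n := Fin (m - 1)) (𝕜 := ℂ) (gramMatrix lam e m X - 1)‖ ≤ 1 / 2}

/-- The least squares coefficients `c = (L_m* L_m)⁻¹ L_m* (f(x¹), …, f(xⁿ))ᵀ`
(meaningful if `L_m(X)` has full column rank). -/
def lsqCoeff (m : ℕ) {n : ℕ} (X : Fin n → D) (f : H) : Fin (m - 1) → ℂ :=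
  (((sampleMatrix lam e m X)ᴴ * sampleMatrix lam e m X)⁻¹ * (sampleMatrix lam e m X)ᴴ) *ᵥ
    (fun i => f (X i))

/-- The least squares approximant `S_X^m f = ∑_{k=1}^{m-1} c_k η_k`. -/
def lsqApprox (m : ℕ) {n : ℕ} (X : Fin n → D) (f : H) : H :=
  ∑ k : Fin (m - 1), lsqCoeff lam e m X f k • eta lam e k

/-- The squared error `‖f - S_X^m f‖²` in `L₂(D, ρ)`. -/
def sqError [MeasurableSpace D] {ρ : Measure D} (h : CompactlyEmbedded ρ H)
    (m : ℕ) {n : ℕ} (X : Fin n → D) (f : H) : ℝ :=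
  ‖h.Id (f - lsqApprox lam e m X f)‖ ^ 2

/-- The event that the least squares problem has full column rank and
`‖f - S_X^m f‖² ≤ (1/δ) σ_m² (1 + 0.06 / log n)`. -/
def successEvent [MeasurableSpace D] {ρ : Measure D} (h : CompactlyEmbedded ρ H)
    (m n : ℕ) (δ : ℝ) (f : H) : Set (Fin n → D) :=
  {X | (sampleMatrix lam e m X).rank = m - 1 ∧
    sqError lam e h m X f ≤ 1 / δ * sigma lam m ^ 2 * (1 + 0.06 / Real.log n)}

end Algorithm

/-- The joint law of `n` independent nodes, each distributed according to `ρ`. -/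
def nodeLaw {D : Type*} [MeasurableSpace D] (ρ : Measure D) (n : ℕ) : Measure (Fin n → D) :=
  Measure.pi fun _ => ρ

end LSRecovery

end

/-! ### Trace moments of matrices under rank one perturbations. -/

section MatrixMoments

open Matrix Finset
open scoped ComplexOrder

/-! Let `g` be the residual of `f` after its projection onto the span of the first `m - 1`
eigenfunctions. Least squares reproduces that span, so the error of `f` is the error of `g`. Since
`g` is orthogonal to the η_k in L₂, Pythagoras splits the squared error into `‖g‖² + ‖b‖²`, where
`b` holds the least squares coefficients of `g`. The first term is at most σ_m², by the spectral
theory of `W` on the orthogonal complement of the leading eigenvectors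
(`IsEigensystem.norm_Id_sq_le`).

On the good event `‖b‖ ≤ 2‖H_m b‖ = (2/n)‖L_m* g(X)‖` (`IsEigensystem.sqError_le`). The entries of
`L_m* g(X)` are sums of `n` independent centred variables, so their expected square sum is at most
`n N ‖g‖²` (`IsEigensystem.integral_correlation_le`). The squared error integrated over the good
event is thus at most `σ_m² (1 + 4N/n)`. With `L = √2 log(2n) - log δ` and `N = n/(48L)`, the extra
term is `1/(12L) ≤ 0.06/log n`. Dividing by the probability of the event gives (a); Markov's
inequality on the event gives (b).

It remains to see that the good event has probability at least `1 - δ`. With `v` the conjugated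
vector of the η_k, `n H_m` is a sum `S` of `n` independent matrices `v v*` with `E v v* = 1` and
`‖v‖² ≤ N`. Instead of exponential moments, two trace moments are estimated: `E tr S^p` for the
large eigenvalues and `E tr (S + n)^{-p}` for the small ones. One factor `S` is written as the sum
of the `v v*`, and by symmetry a single `v` is split off that is independent of the remaining sum
`S'`. The form `v* (S' + v v*)^p v` is compared with one in which `v` no longer enters the matrix:
for positive powers with `v* (S' + N)^p v` (`quadForm_add_outer_pow_le`), for negative ones with `v*
(S' + u)^{-p} v` up to a factor `1 - pN/u` (`le_quadForm_resolventAt_add_outer`). Isotropy then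
turns the form back into a trace, which yields recursions for the moments. Both comparisons rest on
a telescoping sum over the rank one perturbation and on Chebyshev's inequality for commuting
matrices. -/

/-- If two finite families are comonotone, then the product of their weighted sums is at most
the total weight times the weighted sum of the products. -/
theorem weighted_chebyshev {ι : Type*} [Fintype ι] (w a b : ι → ℝ) (hw : ∀ i, 0 ≤ w i)
    (hab : ∀ i j, 0 ≤ (a i - a j) * (b i - b j)) :
    (∑ i, w i * a i) * (∑ i, w i * b i) ≤ (∑ i, w i) * ∑ i, w i * (a i * b i) := by
  -- This symmetrized sum expands to twice the difference of the two sides.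
  have h1 : 0 ≤ ∑ i, ∑ j, w i * w j * ((a i - a j) * (b i - b j)) :=
    sum_nonneg fun i _ => sum_nonneg fun j _ =>
      mul_nonneg (mul_nonneg (hw i) (hw j)) (hab i j)
  have h2 : ∑ i, ∑ j, w i * w j * ((a i - a j) * (b i - b j)) =
      (∑ i, w i * (a i * b i)) * (∑ j, w j) - (∑ i, w i * a i) * (∑ j, w j * b j)
      - ((∑ i, w i * b i) * (∑ j, w j * a j) - (∑ i, w i) * (∑ j, w j * (a j * b j))) := by
    simp only [sum_mul_sum, ← sum_sub_distrib]
    exact sum_congr rfl fun i _ => sum_congr rfl fun j _ => by ring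
  nlinarith

/-- A telescoping formula for the difference of two powers in a noncommutative ring. -/
theorem pow_sub_pow_eq_sum {R : Type*} [Ring R] (x y : R) (k : ℕ) :
    x ^ k - y ^ k = ∑ i ∈ range k, x ^ i * (x - y) * y ^ (k - 1 - i) := by
  induction k with
  | zero => simp
  | succ k ih =>
    rw [sum_range_succ]
    have h : ∑ i ∈ range k, x ^ i * (x - y) * y ^ (k + 1 - 1 - i) = (x ^ k - y ^ k) * y := by
      rw [ih, sum_mul]
      refine sum_congr rfl fun i hi => ?_
      have : k + 1 - 1 - i = (k - 1 - i) + 1 := by have := mem_range.1 hi; omega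
      rw [this, pow_succ, mul_assoc _ _ y]
    rw [h]
    simp only [add_tsub_cancel_right, tsub_self, pow_zero, mul_one, pow_succ]
    noncomm_ring

variable {ι : Type*} [Fintype ι]

/-- The real part of the quadratic form `v ↦ v* M v`. -/
noncomputable def quadForm (M : Matrix ι ι ℂ) (v : ι → ℂ) : ℝ := (star v ⬝ᵥ M *ᵥ v).re

/-- The rank one matrix `v v*`. -/
def outer (v : ι → ℂ) : Matrix ι ι ℂ := vecMulVec v (star v)

omit [Fintype ι] in
theorem outer_isHermitian (v : ι → ℂ) : (outer v).IsHermitian := by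
  unfold outer
  ext i j
  simp [conjTranspose_apply, vecMulVec_apply, mul_comm]

theorem trace_mul_outer (M : Matrix ι ι ℂ) (v : ι → ℂ) :
    (M * outer v).trace = star v ⬝ᵥ M *ᵥ v := by
  rw [outer, mul_vecMulVec, trace_vecMulVec, dotProduct_comm]

/-- A factor `v v*` between two matrices cuts the form at `v` into a product of two forms; every
telescoping sum below is evaluated in this way. -/
theorem dotProduct_mul_outer_mul (P Q : Matrix ι ι ℂ) (v : ι → ℂ) :
    star v ⬝ᵥ (P * outer v * Q) *ᵥ v = (star v ⬝ᵥ P *ᵥ v) * (star v ⬝ᵥ Q *ᵥ v) := by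
  rw [outer, mul_vecMulVec, vecMulVec_mul, vecMulVec_mulVec]
  simp [dotProduct_smul, dotProduct_mulVec, mul_comm]

theorem coe_quadForm {M : Matrix ι ι ℂ} (hM : M.IsHermitian) (v : ι → ℂ) :
    ((quadForm M v : ℝ) : ℂ) = star v ⬝ᵥ M *ᵥ v := by
  refine Complex.ext rfl ?_
  simpa using (hM.im_star_dotProduct_mulVec_self v).symm

theorem quadForm_mul_outer_mul {P Q : Matrix ι ι ℂ} (hP : P.IsHermitian) (hQ : Q.IsHermitian)
    (v : ι → ℂ) : quadForm (P * outer v * Q) v = quadForm P v * quadForm Q v := by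
  rw [quadForm, dotProduct_mul_outer_mul, ← coe_quadForm hP, ← coe_quadForm hQ]
  norm_cast

theorem quadForm_add (M N : Matrix ι ι ℂ) (v : ι → ℂ) :
    quadForm (M + N) v = quadForm M v + quadForm N v := by
  simp [quadForm, add_mulVec]

theorem quadForm_sub (M N : Matrix ι ι ℂ) (v : ι → ℂ) :
    quadForm (M - N) v = quadForm M v - quadForm N v := by
  simp [quadForm, sub_mulVec]

theorem quadForm_sum {κ : Type*} (s : Finset κ) (M : κ → Matrix ι ι ℂ) (v : ι → ℂ) :
    quadForm (∑ k ∈ s, M k) v = ∑ k ∈ s, quadForm (M k) v := by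
  classical
  induction s using Finset.induction_on with
  | empty => simp [quadForm]
  | insert a s ha ih => rw [sum_insert ha, sum_insert ha, quadForm_add, ih]

variable [DecidableEq ι]

/-- Matrices that are diagonal in the basis given by the columns of a unitary matrix. -/
noncomputable def specHom (U : unitaryGroup ι ℂ) : (ι → ℝ) →+* Matrix ι ι ℂ where
  toFun μ := (U : Matrix ι ι ℂ) * diagonal (fun i => (μ i : ℂ)) * star (U : Matrix ι ι ℂ)
  map_one' := by simp
  map_zero' := by simp
  map_add' a b := by
    rw [← add_mul, ← mul_add, diagonal_add]
    simp
  map_mul' a b := by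
    have h : star (U : Matrix ι ι ℂ) * (U : Matrix ι ι ℂ) = 1 := Unitary.coe_star_mul_self U
    calc _ = (U : Matrix ι ι ℂ) * (diagonal (fun i => (a i : ℂ)) * diagonal (fun i => (b i : ℂ)))
          * star (U : Matrix ι ι ℂ) := by simp [diagonal_mul_diagonal]
      _ = (U : Matrix ι ι ℂ) * (diagonal (fun i => (a i : ℂ)) * (star (U : Matrix ι ι ℂ) *
          (U : Matrix ι ι ℂ)) * diagonal (fun i => (b i : ℂ))) * star (U : Matrix ι ι ℂ) := by
          rw [h, mul_one]
      _ = _ := by simp only [mul_assoc]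

theorem specHom_apply (U : unitaryGroup ι ℂ) (μ : ι → ℝ) :
    specHom U μ = (U : Matrix ι ι ℂ) * diagonal (fun i => (μ i : ℂ)) * star (U : Matrix ι ι ℂ) :=
  rfl

theorem specHom_isHermitian (U : unitaryGroup ι ℂ) (μ : ι → ℝ) : (specHom U μ).IsHermitian := by
  rw [specHom_apply, star_eq_conjTranspose]
  refine isHermitian_mul_mul_conjTranspose _ ?_
  rw [isHermitian_diagonal_iff]
  intro i
  simp [IsSelfAdjoint]

theorem eq_specHom {S : Matrix ι ι ℂ} (hS : S.IsHermitian) :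
    S = specHom hS.eigenvectorUnitary hS.eigenvalues := by
  conv_lhs => rw [hS.spectral_theorem]
  rw [specHom_apply, Unitary.conjStarAlgAut_apply]
  rfl

theorem specHom_const (U : unitaryGroup ι ℂ) (c : ℝ) :
    specHom U (fun _ => c) = (c : ℂ) • (1 : Matrix ι ι ℂ) := by
  rw [specHom_apply]
  have : (diagonal fun _ : ι => (c : ℂ)) = (c : ℂ) • (1 : Matrix ι ι ℂ) := by
    rw [smul_one_eq_diagonal]
  rw [this]
  simp

theorem trace_specHom (U : unitaryGroup ι ℂ) (μ : ι → ℝ) :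
    (specHom U μ).trace = ((∑ i, μ i : ℝ) : ℂ) := by
  rw [specHom_apply, trace_mul_comm, ← mul_assoc, Unitary.coe_star_mul_self, one_mul,
    trace_diagonal]
  simp

/-- The weights `|(U* v)_i|²` form the spectral measure of `v`, shared by all matrices diagonal in
`U`, so their forms at `v` are integrals against one measure of total mass `‖v‖²`. -/
theorem quadForm_specHom (U : unitaryGroup ι ℂ) (μ : ι → ℝ) (v : ι → ℂ) :
    quadForm (specHom U μ) v = ∑ i, ‖(star (U : Matrix ι ι ℂ) *ᵥ v) i‖ ^ 2 * μ i := by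
  have h : star v ⬝ᵥ specHom U μ *ᵥ v =
      star (star (U : Matrix ι ι ℂ) *ᵥ v) ⬝ᵥ diagonal (fun i => (μ i : ℂ)) *ᵥ
        (star (U : Matrix ι ι ℂ) *ᵥ v) := by
    rw [specHom_apply, ← mulVec_mulVec, ← mulVec_mulVec, star_mulVec, dotProduct_mulVec,
      star_eq_conjTranspose, conjTranspose_conjTranspose]
  rw [quadForm, h, dotProduct, Complex.re_sum]
  refine sum_congr rfl fun i _ => ?_
  rw [mulVec_diagonal, Pi.star_apply, mul_left_comm, RCLike.star_def, Complex.conj_mul',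
    Complex.re_ofReal_mul, ← Complex.ofReal_pow, Complex.ofReal_re, mul_comm]

theorem quadForm_one (v : ι → ℂ) : quadForm (1 : Matrix ι ι ℂ) v = ∑ i, ‖v i‖ ^ 2 := by
  simpa using quadForm_specHom (1 : unitaryGroup ι ℂ) 1 v

theorem sum_norm_sq_star_mulVec (U : unitaryGroup ι ℂ) (v : ι → ℂ) :
    ∑ i, ‖(star (U : Matrix ι ι ℂ) *ᵥ v) i‖ ^ 2 = ∑ i, ‖v i‖ ^ 2 := by
  rw [← quadForm_one v, ← map_one (specHom U), quadForm_specHom]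
  simp

/-- The weighted Chebyshev inequality for quadratic forms of commuting Hermitian matrices. -/
theorem quadForm_specHom_mul_le (U : unitaryGroup ι ℂ) (a b : ι → ℝ) (v : ι → ℂ)
    (hab : ∀ i j, 0 ≤ (a i - a j) * (b i - b j)) :
    quadForm (specHom U a) v * quadForm (specHom U b) v ≤
      (∑ i, ‖v i‖ ^ 2) * quadForm (specHom U (a * b)) v := by
  rw [← sum_norm_sq_star_mulVec U v]
  simp only [quadForm_specHom]
  exact weighted_chebyshev _ a b (fun i => by positivity) hab

theorem quadForm_specHom_nonneg (U : unitaryGroup ι ℂ) {a : ι → ℝ} (v : ι → ℂ)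
    (ha : ∀ i, 0 ≤ a i) : 0 ≤ quadForm (specHom U a) v := by
  rw [quadForm_specHom]
  exact sum_nonneg fun i _ => mul_nonneg (by positivity) (ha i)

theorem sub_mul_sub_nonneg_pow {x y : ℝ} (hx : 0 ≤ x) (hy : 0 ≤ y) {N : ℝ} (hN : 0 ≤ N)
    (k l : ℕ) : 0 ≤ ((x + N) ^ k - (y + N) ^ k) * (x ^ l - y ^ l) := by
  rcases le_total x y with h | h
  · refine mul_nonneg_of_nonpos_of_nonpos ?_ ?_
    · exact sub_nonpos.2 (by gcongr)
    · exact sub_nonpos.2 (by gcongr)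
  · refine mul_nonneg ?_ ?_
    · exact sub_nonneg.2 (by gcongr)
    · exact sub_nonneg.2 (by gcongr)

/-- A rank one perturbation `v v*` of a positive semidefinite matrix acts on the moments at `v`
at most like the scalar perturbation by `N ≥ ‖v‖²`. -/
theorem quadForm_add_outer_pow_le {S : Matrix ι ι ℂ} (hS : S.PosSemidef) (v : ι → ℂ) {N : ℝ}
    (hv : ∑ i, ‖v i‖ ^ 2 ≤ N) (k : ℕ) :
    quadForm ((S + outer v) ^ k) v ≤ quadForm ((S + (N : ℂ) • (1 : Matrix ι ι ℂ)) ^ k) v := by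
  have hN : 0 ≤ N := le_trans (sum_nonneg fun i _ => by positivity) hv
  set U := hS.isHermitian.eigenvectorUnitary
  set l := hS.isHermitian.eigenvalues with hl
  have hl0 : ∀ i, 0 ≤ l i := hS.eigenvalues_nonneg
  have eS : S = specHom U l := eq_specHom hS.isHermitian
  have eSN : S + (N : ℂ) • (1 : Matrix ι ι ℂ) = specHom U (l + fun _ => N) := by
    rw [map_add, specHom_const, ← eS]
  have hSp : ∀ j, S ^ j = specHom U (l ^ j) := fun j => by rw [map_pow, ← eS]
  have hSNp : ∀ j, (S + (N : ℂ) • (1 : Matrix ι ι ℂ)) ^ j = specHom U ((l + fun _ => N) ^ j) :=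
    fun j => by rw [map_pow, ← eSN]
  have hT : ∀ j, ((S + outer v) ^ j).IsHermitian := fun j =>
    (hS.isHermitian.add (outer_isHermitian v)).pow j
  induction k using Nat.strong_induction_on with
  | _ k ih =>
    have h1 : quadForm ((S + outer v) ^ k) v = quadForm (S ^ k) v +
        ∑ i ∈ range k, quadForm ((S + outer v) ^ i) v * quadForm (S ^ (k - 1 - i)) v := by
      rw [← sub_eq_iff_eq_add', ← quadForm_sub, pow_sub_pow_eq_sum, quadForm_sum]
      refine sum_congr rfl fun i _ => ?_
      rw [add_sub_cancel_left, quadForm_mul_outer_mul (hT i) (hS.isHermitian.pow _)]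
    have h2 : quadForm ((S + (N : ℂ) • (1 : Matrix ι ι ℂ)) ^ k) v = quadForm (S ^ k) v +
        ∑ i ∈ range k, N * quadForm (specHom U ((l + fun _ => N) ^ i * l ^ (k - 1 - i))) v := by
      rw [← sub_eq_iff_eq_add', ← quadForm_sub, pow_sub_pow_eq_sum, quadForm_sum]
      refine sum_congr rfl fun i _ => ?_
      rw [add_sub_cancel_left, map_mul, ← hSNp, ← hSp, mul_smul_comm, smul_mul_assoc, mul_one,
        quadForm, smul_mulVec, dotProduct_smul, smul_eq_mul, Complex.re_ofReal_mul, quadForm]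
    rw [h1, h2]
    -- Termwise, the induction hypothesis replaces the perturbed power by one commuting with `S`. As
    -- `(x + N)^i` and `x^(k-1-i)` are both nondecreasing for `x ≥ 0`, Chebyshev merges the two
    -- forms at the price of `‖v‖² ≤ N`.
    refine add_le_add_right (sum_le_sum fun i hi => ?_) _
    have hg : 0 ≤ quadForm (S ^ (k - 1 - i)) v := by
      rw [hSp]
      exact quadForm_specHom_nonneg U v fun i => pow_nonneg (hl0 i) _
    calc _ ≤ quadForm ((S + (N : ℂ) • (1 : Matrix ι ι ℂ)) ^ i) v * quadForm (S ^ (k - 1 - i)) v :=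
          mul_le_mul_of_nonneg_right (ih i (mem_range.1 hi)) hg
      _ ≤ (∑ i, ‖v i‖ ^ 2) * quadForm (specHom U ((l + fun _ => N) ^ i * l ^ (k - 1 - i))) v := by
          rw [hSNp, hSp]
          exact quadForm_specHom_mul_le U _ _ v fun a b =>
            sub_mul_sub_nonneg_pow (hl0 a) (hl0 b) hN _ _
      _ ≤ _ := mul_le_mul_of_nonneg_right hv <| quadForm_specHom_nonneg U v fun a =>
          mul_nonneg (pow_nonneg (add_nonneg (hl0 a) hN) _) (pow_nonneg (hl0 a) _)

/-- The shifted inverse `(S + u)⁻¹`. -/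
noncomputable def resolventAt (u : ℝ) (S : Matrix ι ι ℂ) : Matrix ι ι ℂ :=
  (S + (u : ℂ) • (1 : Matrix ι ι ℂ))⁻¹

section Resolvent

variable {S : Matrix ι ι ℂ} (hS : S.PosSemidef) {u : ℝ} (hu : 0 < u)
include hS hu

theorem resolventAt_eq_specHom : resolventAt u S =
    specHom hS.isHermitian.eigenvectorUnitary fun i => (hS.isHermitian.eigenvalues i + u)⁻¹ := by
  refine inv_eq_right_inv ?_
  have eSN : S + (u : ℂ) • (1 : Matrix ι ι ℂ) =
      specHom hS.isHermitian.eigenvectorUnitary (hS.isHermitian.eigenvalues + fun _ => u) := by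
    rw [map_add, specHom_const, ← eq_specHom]
  rw [eSN, ← map_mul]
  have : (hS.isHermitian.eigenvalues + fun _ => u) *
      (fun i => (hS.isHermitian.eigenvalues i + u)⁻¹) = 1 := by
    ext i
    have := hS.eigenvalues_nonneg i
    exact mul_inv_cancel₀ (show hS.isHermitian.eigenvalues i + u ≠ 0 by positivity)
  rw [this, map_one]

theorem mul_resolventAt : (S + (u : ℂ) • (1 : Matrix ι ι ℂ)) * resolventAt u S = 1 := by
  refine mul_nonsing_inv _ ?_
  rw [isUnit_iff_ne_zero]
  refine (PosDef.posSemidef_add hS ?_).det_pos.ne'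
  exact PosDef.one.smul (by exact_mod_cast hu)

theorem resolventAt_mul : resolventAt u S * (S + (u : ℂ) • (1 : Matrix ι ι ℂ)) = 1 :=
  mul_eq_one_comm.1 (mul_resolventAt hS hu)

theorem resolventAt_pow_isHermitian (k : ℕ) : (resolventAt u S ^ k).IsHermitian := by
  rw [resolventAt_eq_specHom hS hu]
  exact (specHom_isHermitian _ _).pow k

theorem resolventAt_pow_eq_specHom (k : ℕ) : resolventAt u S ^ k =
    specHom hS.isHermitian.eigenvectorUnitary
      fun i => (hS.isHermitian.eigenvalues i + u)⁻¹ ^ k := by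
  rw [resolventAt_eq_specHom hS hu, ← map_pow]
  rfl

theorem quadForm_resolventAt_pow_nonneg (k : ℕ) (v : ι → ℂ) :
    0 ≤ quadForm (resolventAt u S ^ k) v := by
  rw [resolventAt_pow_eq_specHom hS hu]
  refine quadForm_specHom_nonneg _ v fun i => ?_
  have := hS.eigenvalues_nonneg i
  positivity

theorem trace_resolventAt_pow_nonneg (k : ℕ) : 0 ≤ (resolventAt u S ^ k).trace.re := by
  rw [resolventAt_pow_eq_specHom hS hu, trace_specHom, Complex.ofReal_re]
  refine sum_nonneg fun i _ => ?_
  have := hS.eigenvalues_nonneg i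
  positivity

/-- Powers of `(x + u)⁻¹` are comonotone, so Chebyshev applies; the surplus factor `(x + u)⁻¹` is
then bounded by `1/u`. -/
theorem quadForm_resolventAt_pow_mul_le (v : ι → ℂ) {N : ℝ} (hv : ∑ i, ‖v i‖ ^ 2 ≤ N)
    (k l : ℕ) : quadForm (resolventAt u S ^ k) v * quadForm (resolventAt u S ^ (l + 1)) v ≤
      N / u * quadForm (resolventAt u S ^ (k + l)) v := by
  have hl0 := hS.eigenvalues_nonneg
  simp only [resolventAt_pow_eq_specHom hS hu]
  have hpos : ∀ i, 0 < hS.isHermitian.eigenvalues i + u := fun i => by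
    have := hl0 i; positivity
  refine (quadForm_specHom_mul_le _ _ _ v fun i j => ?_).trans ?_
  · have hi := inv_nonneg.2 (hpos i).le
    have hj := inv_nonneg.2 (hpos j).le
    simpa using sub_mul_sub_nonneg_pow hi hj le_rfl k (l + 1)
  · have hN : 0 ≤ N := le_trans (sum_nonneg fun i _ => by positivity) hv
    rw [div_mul_eq_mul_div, mul_div_assoc]
    refine mul_le_mul hv ?_ ?_ hN
    · simp only [quadForm_specHom, sum_div]
      refine sum_le_sum fun i _ => ?_
      rw [mul_div_assoc]
      refine mul_le_mul_of_nonneg_left ?_ (by positivity)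
      have h1 : (hS.isHermitian.eigenvalues i + u)⁻¹ ≤ u⁻¹ :=
        inv_anti₀ hu (by linarith [hl0 i])
      have h2 := inv_nonneg.2 (hpos i).le
      simp only [Pi.mul_apply]
      rw [div_eq_mul_inv, pow_succ, ← mul_assoc, ← pow_add]
      exact mul_le_mul_of_nonneg_left h1 (by positivity)
    · refine quadForm_specHom_nonneg _ v fun i => ?_
      have := inv_nonneg.2 (hpos i).le
      exact mul_nonneg (by positivity) (by positivity)

omit [DecidableEq ι] hu in
theorem posSemidef_add_outer (v : ι → ℂ) : (S + outer v).PosSemidef :=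
  hS.add (posSemidef_vecMulVec_self_star v)

/-- The resolvent identity. Both orders of the factors are needed, since the two resolvents do not
commute. -/
theorem resolventAt_sub (v : ι → ℂ) :
    resolventAt u S - resolventAt u (S + outer v) =
      resolventAt u (S + outer v) * outer v * resolventAt u S := by
  have h1 := mul_resolventAt hS hu
  have h2 := resolventAt_mul (posSemidef_add_outer hS v) hu
  set B := resolventAt u S
  set C := resolventAt u (S + outer v)
  calc B - C = (C * (S + outer v + (u : ℂ) • (1 : Matrix ι ι ℂ))) * B
        - C * ((S + (u : ℂ) • (1 : Matrix ι ι ℂ)) * B) := by rw [h1, h2, one_mul, mul_one]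
    _ = _ := by noncomm_ring

theorem resolventAt_sub' (v : ι → ℂ) :
    resolventAt u S - resolventAt u (S + outer v) =
      resolventAt u S * outer v * resolventAt u (S + outer v) := by
  have h1 := resolventAt_mul hS hu
  have h2 := mul_resolventAt (posSemidef_add_outer hS v) hu
  set B := resolventAt u S
  set C := resolventAt u (S + outer v)
  calc B - C = B * ((S + outer v + (u : ℂ) • (1 : Matrix ι ι ℂ)) * C)
        - B * (S + (u : ℂ) • (1 : Matrix ι ι ℂ)) * C := by rw [h1, h2, one_mul, mul_one]
    _ = _ := by noncomm_ring

theorem quadForm_resolventAt_add_outer (v : ι → ℂ) (p : ℕ) :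
    quadForm (resolventAt u S ^ p) v = quadForm (resolventAt u (S + outer v) ^ p) v +
      ∑ i ∈ range p, quadForm (resolventAt u (S + outer v) ^ (i + 1)) v *
        quadForm (resolventAt u S ^ (p - 1 - i + 1)) v := by
  have hT := posSemidef_add_outer hS v
  rw [← sub_eq_iff_eq_add', ← neg_inj, ← neg_sub, neg_neg, ← quadForm_sub, pow_sub_pow_eq_sum,
    quadForm_sum, ← sum_neg_distrib]
  refine sum_congr rfl fun i _ => ?_
  rw [← quadForm_mul_outer_mul (resolventAt_pow_isHermitian hT hu _)
    (resolventAt_pow_isHermitian hS hu _), ← neg_sub, resolventAt_sub hS hu v, pow_succ,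
    pow_succ']
  simp only [mul_neg, neg_mul, mul_assoc]
  simp [quadForm, neg_mulVec]

theorem quadForm_resolventAt_add_outer_le (v : ι → ℂ) (p : ℕ) :
    quadForm (resolventAt u (S + outer v) ^ p) v ≤ quadForm (resolventAt u S ^ p) v := by
  rw [quadForm_resolventAt_add_outer hS hu v p]
  refine le_add_of_nonneg_right (sum_nonneg fun i _ => mul_nonneg ?_ ?_)
  · exact quadForm_resolventAt_pow_nonneg (posSemidef_add_outer hS v) hu _ v
  · exact quadForm_resolventAt_pow_nonneg hS hu _ v

/-- Under a rank one perturbation `v v*`, the negative moments at `v` decrease only little. -/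
theorem le_quadForm_resolventAt_add_outer (v : ι → ℂ) {N : ℝ} (hv : ∑ i, ‖v i‖ ^ 2 ≤ N)
    (p : ℕ) : (1 - p * (N / u)) * quadForm (resolventAt u S ^ p) v ≤
      quadForm (resolventAt u (S + outer v) ^ p) v := by
  -- Each of the `p` telescoping terms costs at most `N/u` times the unperturbed form, since the
  -- perturbed factor can be replaced by the larger unperturbed one.
  have h : ∑ i ∈ range p, quadForm (resolventAt u (S + outer v) ^ (i + 1)) v *
        quadForm (resolventAt u S ^ (p - 1 - i + 1)) v ≤
      ∑ i ∈ range p, N / u * quadForm (resolventAt u S ^ p) v := by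
    refine sum_le_sum fun i hi => ?_
    refine (mul_le_mul_of_nonneg_right (quadForm_resolventAt_add_outer_le hS hu v (i + 1))
      (quadForm_resolventAt_pow_nonneg hS hu _ v)).trans ?_
    refine (quadForm_resolventAt_pow_mul_le hS hu v hv (i + 1) (p - 1 - i)).trans_eq ?_
    have : i + 1 + (p - 1 - i) = p := by have := mem_range.1 hi; omega
    rw [this]
  have h' := quadForm_resolventAt_add_outer hS hu v p
  rw [sum_const, card_range, nsmul_eq_mul] at h
  linarith

/-- The product is not Hermitian, so positivity is not automatic. With `B` and `C` the resolvents
before and after the perturbation, `B = C + B v v* C` moves factors from `B` to `C`, each time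
leaving a nonnegative product of two forms. -/
theorem quadForm_resolventAt_mul_nonneg (v : ι → ℂ) (l k : ℕ) :
    0 ≤ quadForm (resolventAt u S ^ l * resolventAt u (S + outer v) ^ k) v := by
  have hT := posSemidef_add_outer hS v
  induction l generalizing k with
  | zero => simpa using quadForm_resolventAt_pow_nonneg hT hu k v
  | succ l ih =>
    have h : resolventAt u S ^ (l + 1) * resolventAt u (S + outer v) ^ k =
        resolventAt u S ^ l * resolventAt u (S + outer v) ^ (k + 1) +
        resolventAt u S ^ (l + 1) * outer v * resolventAt u (S + outer v) ^ (k + 1) := by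
      have h' := resolventAt_sub' hS hu v
      rw [sub_eq_iff_eq_add] at h'
      rw [pow_succ (resolventAt u S), pow_succ' (resolventAt u (S + outer v))]
      calc _ = resolventAt u S ^ l * (resolventAt u S) * resolventAt u (S + outer v) ^ k := rfl
        _ = resolventAt u S ^ l * (resolventAt u S * outer v * resolventAt u (S + outer v) +
              resolventAt u (S + outer v)) * resolventAt u (S + outer v) ^ k := by rw [← h']
        _ = _ := by noncomm_ring
    rw [h, quadForm_add, quadForm_mul_outer_mul (resolventAt_pow_isHermitian hS hu _)
      (resolventAt_pow_isHermitian hT hu _)]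
    exact add_nonneg (ih _) (mul_nonneg (quadForm_resolventAt_pow_nonneg hS hu _ v)
      (quadForm_resolventAt_pow_nonneg hT hu _ v))

/-- By telescoping and cyclicity of the trace, the difference is a sum of the mixed forms of
`quadForm_resolventAt_mul_nonneg`. -/
theorem trace_resolventAt_add_outer_pow_le (v : ι → ℂ) (p : ℕ) :
    (resolventAt u (S + outer v) ^ p).trace.re ≤ (resolventAt u S ^ p).trace.re := by
  rw [← sub_nonneg, ← Complex.sub_re, ← trace_sub, ← neg_sub, pow_sub_pow_eq_sum,
    ← sum_neg_distrib, trace_sum, Complex.re_sum]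
  refine sum_nonneg fun i _ => ?_
  have h : (-(resolventAt u (S + outer v) ^ i * (resolventAt u (S + outer v) - resolventAt u S) *
      resolventAt u S ^ (p - 1 - i))).trace =
      ((resolventAt u S ^ (p - 1 - i + 1) * resolventAt u (S + outer v) ^ (i + 1)) *
        outer v).trace := by
    rw [← neg_sub, resolventAt_sub hS hu v, mul_neg, neg_mul, neg_neg, pow_succ (resolventAt u (S + outer v)), pow_succ' (resolventAt u S)]
    have key : ∀ X C B Y : Matrix ι ι ℂ,
        (X * (C * outer v * B) * Y).trace = (B * Y * (X * C) * outer v).trace := fun X C B Y => by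
      rw [show X * (C * outer v * B) * Y = (X * C * outer v) * (B * Y) by simp only [mul_assoc],
        trace_mul_comm]
      simp only [mul_assoc]
    exact key _ _ _ _
  rw [h, trace_mul_outer]
  exact quadForm_resolventAt_mul_nonneg hS hu v _ _

end Resolvent

end MatrixMoments

/-! ### Concentration of sums of independent rank one matrices. -/

section RandomFrames

open Matrix Finset
open scoped ComplexOrder

/-- A continuous function is bounded on the compact closed ball in which `w` takes its values. This
settles all integrability questions about the random frames. -/
theorem integrable_comp_of_bounded {Ω E : Type*} [MeasurableSpace Ω] {μ : Measure Ω}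
    [IsFiniteMeasure μ] [NormedAddCommGroup E] [ProperSpace E] [MeasurableSpace E] [BorelSpace E]
    {w : Ω → E} (hw : AEMeasurable w μ) {R : ℝ} (hR : ∀ ω, ‖w ω‖ ≤ R) {F : E → ℝ}
    (hF : Continuous F) : Integrable (fun ω => F (w ω)) μ := by
  obtain ⟨C, hC⟩ := (isCompact_closedBall (0 : E) R).exists_bound_of_continuousOn hF.continuousOn
  refine Integrable.of_bound (hF.comp_aestronglyMeasurable hw.aestronglyMeasurable) C
    (ae_of_all _ fun ω => hC _ ?_)
  simpa using hR ω

variable {ι : Type*} [Fintype ι]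

/-- The frame operator `∑ᵢ vᵢ vᵢ*` of finitely many vectors. -/
noncomputable def frameSum {k : ℕ} (V : Fin k → ι → ℂ) : Matrix ι ι ℂ := ∑ i, outer (V i)

omit [Fintype ι] in
theorem continuous_outer : Continuous (outer : (ι → ℂ) → Matrix ι ι ℂ) := by
  unfold outer
  fun_prop

omit [Fintype ι] in
theorem continuous_frameSum {k : ℕ} :
    Continuous (frameSum : (Fin k → ι → ℂ) → Matrix ι ι ℂ) := by
  unfold frameSum
  exact continuous_finsetSum _ fun i _ => continuous_outer.comp (continuous_apply i)

theorem frameSum_posSemidef {k : ℕ} (V : Fin k → ι → ℂ) : (frameSum V).PosSemidef :=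
  posSemidef_sum _ fun i _ => posSemidef_vecMulVec_self_star (V i)

omit [Fintype ι] in
theorem frameSum_insertNth {k : ℕ} (i : Fin (k + 1)) (x : ι → ℂ) (V : Fin k → ι → ℂ) :
    frameSum (i.insertNth x V : Fin (k + 1) → ι → ℂ) = frameSum V + outer x := by
  rw [frameSum, Fin.sum_univ_succAbove _ i, add_comm]
  simp [frameSum]

theorem Continuous.quadForm {X : Type*} [TopologicalSpace X] {M : X → Matrix ι ι ℂ}
    {v : X → ι → ℂ} (hM : Continuous M) (hv : Continuous v) :
    Continuous fun x => quadForm (M x) (v x) :=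
  Complex.continuous_re.comp (hv.star.dotProduct (hM.matrix_mulVec hv))

theorem Continuous.trace_re {X : Type*} [TopologicalSpace X] {M : X → Matrix ι ι ℂ}
    (hM : Continuous M) : Continuous fun x => (M x).trace.re :=
  Complex.continuous_re.comp hM.matrix_trace

theorem continuous_resolventAt [DecidableEq ι] {X : Type*} [TopologicalSpace X] {u : ℝ}
    (hu : 0 < u) {S : X → Matrix ι ι ℂ} (hS : Continuous S) (hpos : ∀ x, (S x).PosSemidef) :
    Continuous fun x => resolventAt u (S x) := by
  rw [continuous_iff_continuousAt]
  intro x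
  unfold resolventAt
  have hne : (S x + (u : ℂ) • (1 : Matrix ι ι ℂ)).det ≠ 0 :=
    (PosDef.posSemidef_add (hpos x) (PosDef.one.smul (by exact_mod_cast hu))).det_pos.ne'
  have h1 : ContinuousAt (fun A : Matrix ι ι ℂ => A⁻¹) (S x + (u : ℂ) • (1 : Matrix ι ι ℂ)) := by
    refine continuousAt_matrix_inv _ ?_
    rw [Ring.inverse_eq_inv']
    exact continuousAt_inv₀ hne
  exact ContinuousAt.comp (f := fun x => S x + (u : ℂ) • (1 : Matrix ι ι ℂ)) h1
    (hS.add continuous_const).continuousAt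

/-- A bounded random vector `v` in `ℂ^ι` with `E v v* = 1`. -/
structure IsBoundedIsotropic {D : Type*} [MeasurableSpace D] (ρ : Measure D) [DecidableEq ι]
    (v : D → ι → ℂ) (N : ℝ) : Prop where
  aemeasurable : AEMeasurable v ρ
  bound : ∀ x, ∑ i, ‖v x i‖ ^ 2 ≤ N
  isotropic : ∀ i j, ∫ x, v x i * star (v x j) ∂ρ = if i = j then 1 else 0

variable [DecidableEq ι] {D : Type*} [MeasurableSpace D] {ρ : Measure D} [IsProbabilityMeasure ρ]
  {v : D → ι → ℂ} {N : ℝ}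

namespace IsBoundedIsotropic

omit [IsProbabilityMeasure ρ] in
theorem norm_le (h : IsBoundedIsotropic ρ v N) (x : D) : ‖v x‖ ≤ √N := by
  refine (pi_norm_le_iff_of_nonneg (Real.sqrt_nonneg _)).2 fun i => Real.le_sqrt_of_sq_le ?_
  exact (single_le_sum (f := fun i => ‖v x i‖ ^ 2) (fun i _ => by positivity)
    (mem_univ i)).trans (h.bound x)

theorem aemeasurable_pi (h : IsBoundedIsotropic ρ v N) (k : ℕ) :
    AEMeasurable (fun (X : Fin k → D) i => v (X i)) (Measure.pi fun _ => ρ) :=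
  aemeasurable_pi_lambda _ fun i =>
    h.aemeasurable.comp_quasiMeasurePreserving (Measure.quasiMeasurePreserving_eval _ i)

theorem integrable_pi (h : IsBoundedIsotropic ρ v N) {k : ℕ} {F : (Fin k → ι → ℂ) → ℝ}
    (hF : Continuous F) :
    Integrable (fun X : Fin k → D => F fun i => v (X i)) (Measure.pi fun _ => ρ) :=
  integrable_comp_of_bounded (h.aemeasurable_pi k) (R := √N)
    (fun _ => (pi_norm_le_iff_of_nonneg (Real.sqrt_nonneg _)).2 fun _ => h.norm_le _) hF

theorem integrable_prod (h : IsBoundedIsotropic ρ v N) {k : ℕ}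
    {F : (ι → ℂ) × (Fin k → ι → ℂ) → ℝ} (hF : Continuous F) :
    Integrable (fun z : D × (Fin k → D) => F (v z.1, fun i => v (z.2 i)))
      (ρ.prod (Measure.pi fun _ => ρ)) := by
  refine integrable_comp_of_bounded (R := √N) (w := fun z : D × (Fin k → D) =>
    ((v z.1, fun i => v (z.2 i)) : (ι → ℂ) × (Fin k → ι → ℂ))) ?_ (fun z => ?_) hF
  · exact (h.aemeasurable.comp_quasiMeasurePreserving Measure.quasiMeasurePreserving_fst).prodMk
      ((h.aemeasurable_pi k).comp_quasiMeasurePreserving Measure.quasiMeasurePreserving_snd)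
  · exact max_le (h.norm_le _)
      ((pi_norm_le_iff_of_nonneg (Real.sqrt_nonneg _)).2 fun i => h.norm_le _)

theorem integral_insertNth {k : ℕ} (i : Fin (k + 1)) (F : (Fin (k + 1) → D) → ℝ) :
    ∫ X, F X ∂(Measure.pi fun _ => ρ) =
      ∫ z : D × (Fin k → D), F (i.insertNth z.1 z.2) ∂(ρ.prod (Measure.pi fun _ => ρ)) := by
  rw [← ((measurePreserving_piFinSuccAbove (fun _ : Fin (k + 1) => ρ) i).symm).integral_comp']
  rfl

omit [Fintype ι] [DecidableEq ι] [MeasurableSpace D] in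
theorem comp_insertNth (v : D → ι → ℂ) {k : ℕ} (i : Fin (k + 1)) (x : D) (Y : Fin k → D) :
    (fun j => v ((i.insertNth x Y : Fin (k + 1) → D) j)) =
      (i.insertNth (v x) (fun j => v (Y j)) : Fin (k + 1) → ι → ℂ) := by
  ext1 j
  rcases Fin.eq_self_or_eq_succAbove i j with rfl | ⟨j, rfl⟩ <;> simp

/-- Since `v* M v = tr (M v v*)`, isotropy `E v v* = 1` leaves the trace of `M`. -/
theorem integral_quadForm (h : IsBoundedIsotropic ρ v N) (M : Matrix ι ι ℂ) :
    ∫ x, quadForm M (v x) ∂ρ = M.trace.re := by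
  have hint : ∀ i j, Integrable (fun x => v x i * star (v x j)) ρ := fun i j => by
    refine Integrable.of_bound (C := √N * √N) ?_ (ae_of_all _ fun x => ?_)
    · have h1 : ∀ i, AEStronglyMeasurable (fun x => v x i) ρ := fun i =>
        ((measurable_pi_apply i).comp_aemeasurable h.aemeasurable).aestronglyMeasurable
      exact (h1 i).mul (continuous_star.comp_aestronglyMeasurable (h1 j))
    · rw [norm_mul, norm_star]
      exact mul_le_mul ((norm_le_pi_norm _ _).trans (h.norm_le x))
        ((norm_le_pi_norm _ _).trans (h.norm_le x)) (norm_nonneg _) (Real.sqrt_nonneg _)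
  have e : ∀ x, star (v x) ⬝ᵥ M *ᵥ v x = ∑ i, ∑ j, M i j * (v x j * star (v x i)) := fun x => by
    simp only [dotProduct, mulVec, Pi.star_apply, mul_sum]
    exact sum_congr rfl fun i _ => sum_congr rfl fun j _ => by ring
  have hint' : ∀ i j, Integrable (fun x => M i j * (v x j * star (v x i))) ρ :=
    fun i j => (hint j i).const_mul _
  have key : ∫ x, star (v x) ⬝ᵥ M *ᵥ v x ∂ρ = M.trace := by
    simp only [e]
    rw [integral_finsetSum _ fun i _ => integrable_finsetSum _ fun j _ => hint' i j]
    simp only [integral_finsetSum _ fun j _ => hint' _ j, integral_const_mul, h.isotropic,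
      mul_ite, mul_one, mul_zero, sum_ite_eq', mem_univ, if_true]
    simp [trace]
  rw [← key]
  have hI : Integrable (fun x => star (v x) ⬝ᵥ M *ᵥ v x) ρ := by
    simp only [e]
    exact integrable_finsetSum _ fun i _ => integrable_finsetSum _ fun j _ => hint' i j
  exact integral_re hI

/-- Averaging a quadratic form over a vector that is independent of the matrix. -/
theorem integral_prod_quadForm (h : IsBoundedIsotropic ρ v N) {k : ℕ}
    {Φ : (Fin k → ι → ℂ) → Matrix ι ι ℂ} (hΦ : Continuous Φ) :
    ∫ z : D × (Fin k → D), quadForm (Φ fun i => v (z.2 i)) (v z.1)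
      ∂(ρ.prod (Measure.pi fun _ => ρ)) =
    ∫ X : Fin k → D, (Φ fun i => v (X i)).trace.re ∂(Measure.pi fun _ => ρ) := by
  rw [integral_prod_symm]
  · simp only [h.integral_quadForm]
  · exact h.integrable_prod (F := fun z => quadForm (Φ z.2) z.1)
      ((hΦ.comp continuous_snd).quadForm continuous_fst)

/-- Leave-one-out formula for the expected trace against the frame operator. -/
theorem integral_trace_mul_frameSum (h : IsBoundedIsotropic ρ v N) {k : ℕ}
    {Φ : Matrix ι ι ℂ → Matrix ι ι ℂ}
    (hΦ : Continuous fun V : Fin (k + 1) → ι → ℂ => Φ (frameSum V)) :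
    ∫ X : Fin (k + 1) → D, (Φ (frameSum fun i => v (X i)) * frameSum fun i => v (X i)).trace.re
      ∂(Measure.pi fun _ => ρ) =
    (k + 1) * ∫ z : D × (Fin k → D),
      quadForm (Φ ((frameSum fun i => v (z.2 i)) + outer (v z.1))) (v z.1)
        ∂(ρ.prod (Measure.pi fun _ => ρ)) := by
  have e : ∀ V : Fin (k + 1) → ι → ℂ, (Φ (frameSum V) * frameSum V).trace.re =
      ∑ i, quadForm (Φ (frameSum V)) (V i) := fun V => by
    have h' : Φ (frameSum V) * frameSum V = ∑ i, Φ (frameSum V) * outer (V i) := by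
      rw [← mul_sum, frameSum]
    rw [h', trace_sum, Complex.re_sum]
    exact sum_congr rfl fun i _ => by rw [trace_mul_outer, quadForm]
  simp only [e]
  rw [integral_finsetSum _ fun i _ => h.integrable_pi
    (F := fun V => quadForm (Φ (frameSum V)) (V i)) (hΦ.quadForm (continuous_apply i))]
  -- The nodes are exchangeable: every index gives the same integral as one separate node against
  -- the other `k`.
  have hi : ∀ i : Fin (k + 1), ∫ X : Fin (k + 1) → D,
      quadForm (Φ (frameSum fun i => v (X i))) (v (X i)) ∂(Measure.pi fun _ => ρ) =
      ∫ z : D × (Fin k → D), quadForm (Φ ((frameSum fun i => v (z.2 i)) + outer (v z.1))) (v z.1)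
        ∂(ρ.prod (Measure.pi fun _ => ρ)) := fun i => by
    rw [integral_insertNth i]
    simp only [comp_insertNth, frameSum_insertNth, Fin.insertNth_apply_same]
  simp [hi]

/-- Moment bound for the frame operator of independent isotropic vectors. -/
theorem integral_trace_frameSum_pow_le (h : IsBoundedIsotropic ρ v N) (hN : 0 ≤ N) (k p : ℕ) :
    ∫ X : Fin k → D, ((frameSum fun i => v (X i)) ^ p).trace.re ∂(Measure.pi fun _ => ρ) ≤
      Fintype.card ι * (k + p * N) ^ p := by
  induction k generalizing p with
  | zero =>
    rcases p with _ | p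
    · simp
    · simp [frameSum]
      positivity
  | succ k ih =>
    rcases p with _ | p
    · simp
    have hc : Continuous fun V : Fin k → ι → ℂ => (frameSum V + (N : ℂ) • (1 : Matrix ι ι ℂ)) ^ p :=
      (continuous_frameSum.add continuous_const).pow p
    have h1 : ∫ X : Fin (k + 1) → D, ((frameSum fun i => v (X i)) ^ (p + 1)).trace.re
          ∂(Measure.pi fun _ => ρ) ≤
        (k + 1) * ∫ X : Fin k → D,
          (((frameSum fun i => v (X i)) + (N : ℂ) • (1 : Matrix ι ι ℂ)) ^ p).trace.re
            ∂(Measure.pi fun _ => ρ) := by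
      simp only [pow_succ]
      rw [h.integral_trace_mul_frameSum (Φ := fun M => M ^ p) (continuous_frameSum.pow p),
        ← h.integral_prod_quadForm (Φ := fun V => (frameSum V + (N : ℂ) • (1 : Matrix ι ι ℂ)) ^ p)
          hc]
      refine mul_le_mul_of_nonneg_left (integral_mono ?_ ?_ fun z => ?_) (by positivity)
      · exact h.integrable_prod (F := fun z => quadForm ((frameSum z.2 + outer z.1) ^ p) z.1)
          ((((continuous_frameSum.comp continuous_snd).add
            (continuous_outer.comp continuous_fst)).pow p).quadForm continuous_fst)
      · exact h.integrable_prod (F := fun z =>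
          quadForm ((frameSum z.2 + (N : ℂ) • (1 : Matrix ι ι ℂ)) ^ p) z.1)
          ((hc.comp continuous_snd).quadForm continuous_fst)
      · exact quadForm_add_outer_pow_le (frameSum_posSemidef _) _ (h.bound _) p
    -- The scalar shift is expanded binomially so that the induction hypothesis for `k` vectors
    -- applies to each power. Bounding `j N` by `p N` inside the base lets the binomial sum close up
    -- again.
    have e : ∀ S : Matrix ι ι ℂ, ((S + (N : ℂ) • (1 : Matrix ι ι ℂ)) ^ p).trace.re =
        ∑ j ∈ range (p + 1), (N ^ (p - j) * p.choose j) * (S ^ j).trace.re := fun S => by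
      have hcomm : Commute S ((N : ℂ) • (1 : Matrix ι ι ℂ)) :=
        (Commute.one_right S).smul_right _
      rw [hcomm.add_pow, trace_sum, Complex.re_sum]
      refine sum_congr rfl fun j _ => ?_
      have : S ^ j * ((N : ℂ) • (1 : Matrix ι ι ℂ)) ^ (p - j) * (p.choose j : Matrix ι ι ℂ) =
          ((N ^ (p - j) * p.choose j : ℝ) : ℂ) • S ^ j := by
        rw [smul_pow, one_pow, mul_smul_comm, mul_one, ← nsmul_eq_mul', ← Nat.cast_smul_eq_nsmul ℂ,
          smul_smul, mul_comm]
        push_cast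
        rfl
      rw [this, trace_smul, smul_eq_mul, Complex.re_ofReal_mul]
    have h2 : ∫ X : Fin k → D,
          (((frameSum fun i => v (X i)) + (N : ℂ) • (1 : Matrix ι ι ℂ)) ^ p).trace.re
            ∂(Measure.pi fun _ => ρ) ≤ Fintype.card ι * (k + (p + 1) * N) ^ p := by
      simp only [e]
      rw [integral_finsetSum _ fun j _ => (h.integrable_pi (F := fun V => (frameSum V ^ j).trace.re)
        (continuous_frameSum.pow j).trace_re).const_mul _]
      simp only [integral_const_mul]
      calc _ ≤ ∑ j ∈ range (p + 1), (N ^ (p - j) * p.choose j) *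
            (Fintype.card ι * (k + p * N) ^ j) := by
            refine sum_le_sum fun j hj => mul_le_mul_of_nonneg_left ((ih j).trans ?_)
              (by positivity)
            have : (j : ℝ) ≤ p := by exact_mod_cast Nat.lt_succ_iff.1 (mem_range.1 hj)
            gcongr
        _ = Fintype.card ι * ((k + p * N) + N) ^ p := by
            rw [add_pow, mul_sum]
            exact sum_congr rfl fun j _ => by ring
        _ = _ := by ring
    calc _ ≤ (k + 1) * (Fintype.card ι * (k + (p + 1) * N) ^ p) :=
          h1.trans (mul_le_mul_of_nonneg_left h2 (by positivity))
      _ = Fintype.card ι * ((k + (p + 1) * N) ^ p * (k + 1)) := by ring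
      _ ≤ Fintype.card ι * ((k + 1 + (p + 1) * N) ^ p * (k + 1 + (p + 1) * N)) := by
          have : 0 ≤ (p + 1) * N := by positivity
          have h3 : (k + (p + 1) * N : ℝ) ≤ k + 1 + (p + 1) * N := by linarith
          have h4 : (k + 1 : ℝ) ≤ k + 1 + (p + 1) * N := by linarith
          gcongr
      _ = _ := by push_cast; ring

/-- Bound for the negative moments of the shifted frame operator of independent isotropic
vectors. -/
theorem integral_trace_resolventAt_pow_le (h : IsBoundedIsotropic ρ v N) (hN : 0 ≤ N)
    {u : ℝ} (hu : 0 < u) {c : ℝ} (hc : 0 ≤ c) (k p : ℕ) (hp : c ≤ 1 - p * (N / u)) :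
    ∫ X : Fin (k + 1) → D, (resolventAt u (frameSum fun i => v (X i)) ^ p).trace.re
      ∂(Measure.pi fun _ => ρ) ≤ Fintype.card ι * ((u + (k + 1) * c)⁻¹) ^ p := by
  have hcont : ∀ k p, Continuous fun V : Fin k → ι → ℂ => resolventAt u (frameSum V) ^ p :=
    fun k p => (continuous_resolventAt hu continuous_frameSum frameSum_posSemidef).pow p
  have hcont' : ∀ p, Continuous fun z : (ι → ℂ) × (Fin k → ι → ℂ) =>
      resolventAt u (frameSum z.2 + outer z.1) ^ p := fun p =>
    (continuous_resolventAt hu ((continuous_frameSum.comp continuous_snd).add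
      (continuous_outer.comp continuous_fst)) fun z =>
        posSemidef_add_outer (frameSum_posSemidef _) _).pow p
  induction p with
  | zero => simp
  | succ p ih =>
    have hNu : 0 ≤ N / u := by positivity
    push_cast at hp
    specialize ih (hp.trans (by nlinarith))
    -- Splitting off one vector leaves moments of `k` vectors; this returns to `k + 1`, so that the
    -- recursion runs in `p` alone.
    have hmono : ∫ X : Fin (k + 1) → D, (resolventAt u (frameSum fun i => v (X i)) ^ (p + 1)).trace.re
          ∂(Measure.pi fun _ => ρ) ≤
        ∫ X : Fin k → D, (resolventAt u (frameSum fun i => v (X i)) ^ (p + 1)).trace.re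
          ∂(Measure.pi fun _ => ρ) := by
      rw [integral_insertNth 0]
      simp only [comp_insertNth, frameSum_insertNth]
      have e : ∫ X : Fin k → D, (resolventAt u (frameSum fun i => v (X i)) ^ (p + 1)).trace.re
          ∂(Measure.pi fun _ => ρ) = ∫ z : D × (Fin k → D),
            (resolventAt u (frameSum fun i => v (z.2 i)) ^ (p + 1)).trace.re
            ∂(ρ.prod (Measure.pi fun _ => ρ)) := by
        rw [integral_fun_snd (f := fun Y : Fin k → D =>
          (resolventAt u (frameSum fun i => v (Y i)) ^ (p + 1)).trace.re)]
        simp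
      rw [e]
      refine integral_mono ?_ ?_ fun z => ?_
      · exact h.integrable_prod (F := fun z =>
          (resolventAt u (frameSum z.2 + outer z.1) ^ (p + 1)).trace.re) (hcont' _).trace_re
      · exact h.integrable_prod (F := fun z =>
          (resolventAt u (frameSum z.2) ^ (p + 1)).trace.re)
            ((hcont _ _).comp continuous_snd).trace_re
      · exact trace_resolventAt_add_outer_pow_le (frameSum_posSemidef _) hu _ _
    -- With `R` the resolvent, `R^p = R^(p+1) (S + u)`. The part with `S` goes to the leave-one-out
    -- formula.
    have hrec : ∫ X : Fin (k + 1) → D, (resolventAt u (frameSum fun i => v (X i)) ^ p).trace.re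
          ∂(Measure.pi fun _ => ρ) =
        (∫ X : Fin (k + 1) → D, (resolventAt u (frameSum fun i => v (X i)) ^ (p + 1) *
          frameSum fun i => v (X i)).trace.re ∂(Measure.pi fun _ => ρ)) +
        u * ∫ X : Fin (k + 1) → D, (resolventAt u (frameSum fun i => v (X i)) ^ (p + 1)).trace.re
          ∂(Measure.pi fun _ => ρ) := by
      rw [← integral_const_mul, ← integral_add]
      · refine integral_congr_ae (ae_of_all _ fun X => ?_)
        have hS := frameSum_posSemidef fun i => v (X i)
        have h1 := resolventAt_mul hS hu
        dsimp only
        rw [← Complex.re_ofReal_mul, ← Complex.add_re, ← smul_eq_mul (u : ℂ), ← trace_smul, ← trace_add]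
        congr 2
        conv_lhs => rw [← mul_one (resolventAt u _ ^ p), ← h1, ← mul_assoc, ← pow_succ, mul_add,
          mul_smul_comm, mul_one]
      · exact h.integrable_pi (F := fun V => (resolventAt u (frameSum V) ^ (p + 1) *
          frameSum V).trace.re) ((hcont _ _).matrix_mul continuous_frameSum).trace_re
      · exact (h.integrable_pi (F := fun V => (resolventAt u (frameSum V) ^ (p + 1)).trace.re)
          (hcont _ _).trace_re).const_mul _
    have hlow : c * ∫ X : Fin k → D,
          (resolventAt u (frameSum fun i => v (X i)) ^ (p + 1)).trace.re
            ∂(Measure.pi fun _ => ρ) ≤ ∫ z : D × (Fin k → D),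
          quadForm (resolventAt u ((frameSum fun i => v (z.2 i)) + outer (v z.1)) ^ (p + 1))
            (v z.1) ∂(ρ.prod (Measure.pi fun _ => ρ)) := by
      rw [← h.integral_prod_quadForm (Φ := fun V => resolventAt u (frameSum V) ^ (p + 1))
        (hcont _ _), ← integral_const_mul]
      refine integral_mono ?_ ?_ fun z => ?_
      · exact (h.integrable_prod (F := fun z => quadForm (resolventAt u (frameSum z.2) ^ (p + 1))
          z.1) (((hcont _ _).comp continuous_snd).quadForm continuous_fst)).const_mul _
      · exact h.integrable_prod (F := fun z =>
          quadForm (resolventAt u (frameSum z.2 + outer z.1) ^ (p + 1)) z.1)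
            ((hcont' _).quadForm continuous_fst)
      · have hS := frameSum_posSemidef fun i => v (z.2 i)
        refine le_trans ?_ (le_quadForm_resolventAt_add_outer hS hu _ (h.bound _) _)
        refine mul_le_mul_of_nonneg_right ?_ (quadForm_resolventAt_pow_nonneg hS hu _ _)
        push_cast
        exact hp
    rw [h.integral_trace_mul_frameSum (Φ := fun M => resolventAt u M ^ (p + 1)) (hcont _ _)]
      at hrec
    have hpos : 0 < u + (k + 1) * c := by positivity
    rw [pow_succ, ← mul_assoc, ← div_eq_mul_inv, le_div_iff₀ hpos]
    refine le_trans ?_ ih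
    rw [hrec]
    have := mul_le_mul_of_nonneg_left ((mul_le_mul_of_nonneg_left hmono hc).trans hlow)
      (show (0 : ℝ) ≤ k + 1 by positivity)
    linarith

end IsBoundedIsotropic

theorem norm_toEuclideanCLM_specHom_le (U : unitaryGroup ι ℂ) {μ : ι → ℝ} {C : ℝ} (hC : 0 ≤ C)
    (hμ : ∀ i, |μ i| ≤ C) : ‖toEuclideanCLM (n := ι) (𝕜 := ℂ) (specHom U μ)‖ ≤ C := by
  open scoped Matrix.Norms.L2Operator in
  rw [l2_opNorm_toEuclideanCLM, specHom_apply, ← Unitary.coe_star, CStarRing.norm_mul_coe_unitary,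
    CStarRing.norm_coe_unitary_mul, l2_opNorm_diagonal]
  refine (pi_norm_le_iff_of_nonneg hC).2 fun i => ?_
  rw [Complex.norm_real]
  exact hμ i

theorem smul_sub_one_eq_specHom {S : Matrix ι ι ℂ} (hS : S.IsHermitian) (n : ℕ) :
    (1 / n : ℂ) • S - 1 =
      specHom hS.eigenvectorUnitary ((fun _ => (1 / n : ℝ)) * hS.eigenvalues - 1) := by
  rw [map_sub, map_mul, map_one, specHom_const, ← eq_specHom hS]
  simp

/-- A bad matrix has an eigenvalue `x` above `3n/2` or below `n/2`. In the second case `x + n <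
3n/2`, so the shift by `n` gives both traces the same threshold up to inversion. -/
theorem trace_frameSum_or_resolventAt {S : Matrix ι ι ℂ} (hS : S.PosSemidef) {n : ℕ} (hn : 0 < n)
    (p : ℕ) (hbad : ¬ ‖toEuclideanCLM (n := ι) (𝕜 := ℂ) ((1 / n : ℂ) • S - 1)‖ ≤ 1 / 2) :
    (3 / 2 * n : ℝ) ^ p ≤ (S ^ p).trace.re ∨
      (3 / 2 * n : ℝ)⁻¹ ^ p ≤ (resolventAt n S ^ p).trace.re := by
  have hn' : (0 : ℝ) < n := by exact_mod_cast hn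
  have hl0 := hS.eigenvalues_nonneg
  by_contra! hcon
  apply hbad
  rw [smul_sub_one_eq_specHom hS.isHermitian]
  refine norm_toEuclideanCLM_specHom_le _ (by norm_num) fun i => ?_
  have e1 : (S ^ p).trace.re = ∑ i, hS.isHermitian.eigenvalues i ^ p := by
    have : S ^ p = specHom hS.isHermitian.eigenvectorUnitary (hS.isHermitian.eigenvalues ^ p) := by
      rw [map_pow, ← eq_specHom hS.isHermitian]
    rw [this, trace_specHom, Complex.ofReal_re]
    rfl
  have e2 : (resolventAt n S ^ p).trace.re = ∑ i, (hS.isHermitian.eigenvalues i + n)⁻¹ ^ p := by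
    rw [resolventAt_pow_eq_specHom hS hn', trace_specHom, Complex.ofReal_re]
  rw [e1, e2] at hcon
  have h1 : hS.isHermitian.eigenvalues i ^ p < (3 / 2 * n : ℝ) ^ p :=
    (single_le_sum (f := fun i => hS.isHermitian.eigenvalues i ^ p)
      (fun i _ => pow_nonneg (hl0 i) p) (mem_univ i)).trans_lt hcon.1
  have h2 : (hS.isHermitian.eigenvalues i + n)⁻¹ ^ p < (3 / 2 * n : ℝ)⁻¹ ^ p :=
    (single_le_sum (f := fun i => (hS.isHermitian.eigenvalues i + n)⁻¹ ^ p)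
      (fun i _ => pow_nonneg (inv_nonneg.2 (add_nonneg (hl0 i) hn'.le)) p)
      (mem_univ i)).trans_lt hcon.2
  have h1' := lt_of_pow_lt_pow_left₀ p (by positivity) h1
  have h2' := lt_of_pow_lt_pow_left₀ p (by positivity) h2
  rw [inv_lt_inv₀ (by have := hl0 i; positivity) (by positivity)] at h2'
  have e : ((fun _ => (1 / n : ℝ)) * hS.isHermitian.eigenvalues - 1 : ι → ℝ) i =
      hS.isHermitian.eigenvalues i / n - 1 := by
    simp only [Pi.sub_apply, Pi.mul_apply, Pi.one_apply]; ring
  rw [e, abs_le]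
  constructor
  · have : 1 / 2 ≤ hS.isHermitian.eigenvalues i / n := by
      rw [le_div_iff₀ hn']; linarith
    linarith
  · have : hS.isHermitian.eigenvalues i / n ≤ 3 / 2 := by
      rw [div_le_iff₀ hn']; linarith
    linarith

/-- Concentration of the normalized frame operator of independent bounded isotropic vectors. -/
theorem IsBoundedIsotropic.measureReal_norm_gt_le (h : IsBoundedIsotropic ρ v N) (hN : 0 ≤ N)
    {n : ℕ} (hn : 0 < n) (p : ℕ) (hp : p * (N / n) ≤ 1 / 4) :
    (Measure.pi fun _ : Fin n => ρ).real
      {X | ‖toEuclideanCLM (n := ι) (𝕜 := ℂ) ((1 / n : ℂ) • (frameSum fun i => v (X i)) - 1)‖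
        ≤ 1 / 2}ᶜ ≤ 2 * Fintype.card ι * (6 / 7 : ℝ) ^ p := by
  have hn' : (0 : ℝ) < n := by exact_mod_cast hn
  set P := Measure.pi fun _ : Fin n => ρ with hP
  have hS : ∀ X : Fin n → D, (frameSum fun i => v (X i)).PosSemidef := fun X =>
    frameSum_posSemidef _
  have hup := h.integral_trace_frameSum_pow_le hN n p
  have hlow : ∫ X : Fin n → D, (resolventAt n (frameSum fun i => v (X i)) ^ p).trace.re ∂P ≤
      Fintype.card ι * ((n + n * (3 / 4 : ℝ))⁻¹) ^ p := by
    obtain ⟨k, rfl⟩ : ∃ k, n = k + 1 := ⟨n - 1, by omega⟩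
    have := h.integral_trace_resolventAt_pow_le hN hn' (c := 3 / 4) (by norm_num) k p (by linarith)
    push_cast at this ⊢
    exact this
  have hm1 := mul_meas_ge_le_integral_of_nonneg (μ := P)
    (f := fun X : Fin n → D => ((frameSum fun i => v (X i)) ^ p).trace.re)
    (ae_of_all _ fun X => by
      have := (hS X).pow p
      exact (Complex.le_def.1 this.trace_nonneg).1)
    (h.integrable_pi (F := fun V => (frameSum V ^ p).trace.re)
      (continuous_frameSum.pow p).trace_re) ((3 / 2 * n : ℝ) ^ p)
  have hm2 := mul_meas_ge_le_integral_of_nonneg (μ := P)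
    (f := fun X : Fin n → D => (resolventAt n (frameSum fun i => v (X i)) ^ p).trace.re)
    (ae_of_all _ fun X => trace_resolventAt_pow_nonneg (hS X) hn' p)
    (h.integrable_pi (F := fun V => (resolventAt n (frameSum V) ^ p).trace.re)
      ((continuous_resolventAt hn' continuous_frameSum frameSum_posSemidef).pow p).trace_re)
    ((3 / 2 * n : ℝ)⁻¹ ^ p)
  have hsub : {X : Fin n → D | ‖toEuclideanCLM (n := ι) (𝕜 := ℂ)
      ((1 / n : ℂ) • (frameSum fun i => v (X i)) - 1)‖ ≤ 1 / 2}ᶜ ⊆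
      {X | (3 / 2 * n : ℝ) ^ p ≤ ((frameSum fun i => v (X i)) ^ p).trace.re} ∪
      {X | (3 / 2 * n : ℝ)⁻¹ ^ p ≤ (resolventAt n (frameSum fun i => v (X i)) ^ p).trace.re} :=
    fun X hX => trace_frameSum_or_resolventAt (hS X) hn p hX
  refine (measureReal_mono hsub).trans ((measureReal_union_le _ _).trans ?_)
  -- Markov's inequality: `n + pN ≤ 5n/4`, which is `5/6 ≤ 6/7` of the threshold `3n/2`. The
  -- resolvent bound below gives exactly `(3/2)/(7/4) = 6/7`.
  have b1 : P.real {X | (3 / 2 * n : ℝ) ^ p ≤ ((frameSum fun i => v (X i)) ^ p).trace.re} ≤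
      Fintype.card ι * (6 / 7 : ℝ) ^ p := by
    have hpos : 0 < (3 / 2 * n : ℝ) ^ p := by positivity
    refine le_of_mul_le_mul_left ((hm1.trans hup).trans ?_) hpos
    have : (n + p * N : ℝ) ≤ (3 / 2 * n) * (6 / 7) := by
      have : p * N ≤ 1 / 4 * n := by
        rw [← mul_div_assoc, div_le_iff₀ hn'] at hp; exact hp
      linarith
    calc _ ≤ Fintype.card ι * ((3 / 2 * n) * (6 / 7) : ℝ) ^ p := by gcongr
      _ = _ := by rw [mul_pow]; ring
  have b2 : P.real {X | (3 / 2 * n : ℝ)⁻¹ ^ p ≤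
      (resolventAt n (frameSum fun i => v (X i)) ^ p).trace.re} ≤
      Fintype.card ι * (6 / 7 : ℝ) ^ p := by
    have hpos : 0 < (3 / 2 * n : ℝ)⁻¹ ^ p := by positivity
    refine le_of_mul_le_mul_left ((hm2.trans hlow).trans_eq ?_) hpos
    have : (n + n * (3 / 4) : ℝ)⁻¹ = (3 / 2 * n : ℝ)⁻¹ * (6 / 7) := by field_simp; norm_num
    rw [this, mul_pow]; ring
  linarith

/-- From `6/7 ≤ e^(-1/7)` and a floor above `12L - 1`, the power is at most `e^(-L)` once `12L - 1 ≥
7L`, that is `L ≥ 1/5`. Finally `√2 ≥ 1` gives `e^(-L) ≤ δ/(2n)`. -/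
theorem exp_tail_bound {d n δ L : ℝ} (hdn : d ≤ n) (hn : 1 ≤ n) (hδ : 0 < δ)
    (hL : L = √2 * Real.log (2 * n) - Real.log δ) (hL' : 1 / 5 ≤ L) :
    2 * d * (6 / 7 : ℝ) ^ ⌊12 * L⌋₊ ≤ δ := by
  have hp : 12 * L - 1 ≤ ⌊12 * L⌋₊ := by
    have := Nat.lt_floor_add_one (12 * L)
    linarith
  have h1 : (6 / 7 : ℝ) ^ ⌊12 * L⌋₊ ≤ Real.exp (-L) := by
    have h67 : (6 / 7 : ℝ) ≤ Real.exp (-(1 / 7)) := by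
      have := Real.add_one_le_exp (-(1 / 7) : ℝ)
      linarith
    calc (6 / 7 : ℝ) ^ ⌊12 * L⌋₊ ≤ Real.exp (-(1 / 7)) ^ ⌊12 * L⌋₊ := by gcongr
      _ = Real.exp (⌊12 * L⌋₊ * -(1 / 7)) := by rw [Real.exp_nat_mul]
      _ ≤ Real.exp (-L) := Real.exp_le_exp.2 (by linarith)
  have h2 : Real.exp (-L) ≤ δ / (2 * n) := by
    rw [← Real.exp_log hδ, ← Real.exp_log (show (0 : ℝ) < 2 * n by linarith), ← Real.exp_sub]
    refine Real.exp_le_exp.2 ?_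
    have : 0 ≤ Real.log (2 * n) := Real.log_nonneg (by linarith)
    have h2 : 1 ≤ √2 := Real.one_le_sqrt.2 (by norm_num)
    rw [hL]
    nlinarith
  calc 2 * d * (6 / 7 : ℝ) ^ ⌊12 * L⌋₊ ≤ 2 * n * (δ / (2 * n)) := by
        gcongr
        exact h1.trans h2
    _ = δ := by field_simp

end RandomFrames

/-! ### Eigenvalues and norms of compact positive operators. -/

section SpectralEstimate

open Module End

variable {E : Type*} [NormedAddCommGroup E] [InnerProductSpace ℂ E] [CompleteSpace E]

/-- The norm of a positive compact operator is bounded by its largest eigenvalue. -/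
theorem norm_le_of_forall_eigenvalue_le {T : E →L[ℂ] E} (hT : IsCompactOperator T)
    (hsymm : T.IsSymmetric) (hpos : ∀ x, 0 ≤ (inner ℂ x (T x)).re) {c : ℝ} (hc : 0 ≤ c)
    (h : ∀ (t : ℝ) (x : E), 0 < t → x ≠ 0 → T x = (t : ℂ) • x → t ≤ c) : ‖T‖ ≤ c := by
  have hr : spectralRadius ℂ T ≤ ENNReal.ofReal c := by
    -- Nonzero spectral values of a compact operator are eigenvalues, and for a self-adjoint
    -- operator the spectral radius is the norm.
    refine iSup₂_le fun z hz => ?_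
    rcases eq_or_ne z 0 with rfl | hz0
    · simp
    have he := (hT.hasEigenvalue_iff_mem_spectrum hz0).2 hz
    have hreal : ((z.re : ℝ) : ℂ) = z := by
      have := LinearMap.IsSymmetric.conj_eigenvalue_eq_self hsymm he
      exact Complex.conj_eq_iff_re.1 this
    rw [← hreal] at he
    have hnn : 0 ≤ z.re := eigenvalue_nonneg_of_nonneg he hpos
    have hne : z.re ≠ 0 := fun h0 => hz0 (by rw [← hreal, h0]; simp)
    obtain ⟨x, hx⟩ := he.exists_hasEigenvector
    have hle := h z.re x (lt_of_le_of_ne hnn hne.symm) hx.2 hx.apply_eq_smul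
    rw [← hreal, ← enorm_eq_nnnorm, ← ofReal_norm, Complex.norm_real, Real.norm_of_nonneg hnn]
    exact ENNReal.ofReal_le_ofReal hle
  rw [T.spectralRadius_eq_nnnorm hsymm.isSelfAdjoint, ← enorm_eq_nnnorm, ← ofReal_norm] at hr
  exact (ENNReal.ofReal_le_ofReal_iff hc).1 hr

end SpectralEstimate

/-! ### The embedding, its eigensystem and the least squares error. -/

namespace LSRecovery

open Matrix

section Embedding

variable {D : Type*} [MeasurableSpace D] {ρ : Measure D}
variable {H : Type*} [NormedAddCommGroup H] [InnerProductSpace ℂ H] [RKHS ℂ H D ℂ]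

theorem CompactlyEmbedded.coeFn_Id (h : CompactlyEmbedded ρ H) (f : H) : h.Id f =ᵐ[ρ] f :=
  (h.memLp f).coeFn_toLp

theorem CompactlyEmbedded.inner_Id (h : CompactlyEmbedded ρ H) (f g : H) :
    inner ℂ (h.Id f) (h.Id g) = ∫ x, g x * star (f x) ∂ρ := by
  rw [L2.inner_def]
  refine integral_congr_ae ?_
  filter_upwards [h.coeFn_Id f, h.coeFn_Id g] with x hf hg
  rw [hf, hg]
  rfl

theorem CompactlyEmbedded.norm_Id_sq (h : CompactlyEmbedded ρ H) (f : H) :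
    ‖h.Id f‖ ^ 2 = ∫ x, ‖f x‖ ^ 2 ∂ρ := by
  have h1 : ((‖h.Id f‖ ^ 2 : ℝ) : ℂ) = ((∫ x, ‖f x‖ ^ 2 ∂ρ : ℝ) : ℂ) := by
    rw [← integral_complex_ofReal]
    push_cast
    refine (inner_self_eq_norm_sq_to_K (𝕜 := ℂ) (h.Id f)).symm.trans ?_
    rw [h.inner_Id]
    refine integral_congr_ae (ae_of_all _ fun x => ?_)
    simp [Complex.mul_conj']
  exact_mod_cast h1

variable [CompleteSpace H]

theorem CompactlyEmbedded.inner_W (h : CompactlyEmbedded ρ H) (f g : H) :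
    inner ℂ (h.W f) g = inner ℂ (h.Id f) (h.Id g) := by
  rw [CompactlyEmbedded.W, ContinuousLinearMap.comp_apply, ContinuousLinearMap.adjoint_inner_left]

theorem CompactlyEmbedded.inner_W' (h : CompactlyEmbedded ρ H) (f g : H) :
    inner ℂ f (h.W g) = inner ℂ (h.Id f) (h.Id g) := by
  rw [CompactlyEmbedded.W, ContinuousLinearMap.comp_apply, ContinuousLinearMap.adjoint_inner_right]

theorem CompactlyEmbedded.isCompactOperator_W (h : CompactlyEmbedded ρ H) :
    IsCompactOperator h.W :=
  IsCompactOperator.clm_comp (f := h.Id) h.compact (ContinuousLinearMap.adjoint h.Id)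

theorem CompactlyEmbedded.isSymmetric_W (h : CompactlyEmbedded ρ H) : h.W.IsSymmetric :=
  fun f g => (h.inner_W f g).trans (h.inner_W' f g).symm

variable {h : CompactlyEmbedded ρ H} {lam : ℕ → ℝ} {e : ℕ → H}

/-- On the orthogonal complement of the first `d` eigenvectors, the embedding has norm at most
the next singular number. -/
theorem IsEigensystem.norm_Id_sq_le (he : IsEigensystem h.W lam e) {d : ℕ}
    (hpos : ∀ k < d, 0 < lam k) {g : H} (hg : ∀ k < d, inner ℂ (e k) g = 0) :
    ‖h.Id g‖ ^ 2 ≤ lam d * ‖g‖ ^ 2 := by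
  set S : Submodule ℂ H := Submodule.span ℂ (e '' {j | j < d})
  have hmem : ∀ x : H, x ∈ Sᗮ ↔ ∀ k < d, inner ℂ (e k) x = 0 := fun x => by
    rw [Submodule.mem_orthogonal]
    refine ⟨fun hx k hk => hx _ (Submodule.subset_span ⟨k, hk, rfl⟩), fun hx u hu => ?_⟩
    induction hu using Submodule.span_induction with
    | mem y hy => obtain ⟨k, hk, rfl⟩ := hy; exact hx k hk
    | zero => simp
    | add y z _ _ hy hz => rw [inner_add_left, hy, hz, add_zero]
    | smul a y _ hy => rw [inner_smul_left, hy, mul_zero]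
  have hinv : ∀ x ∈ Sᗮ, h.W x ∈ Sᗮ := fun x hx => by
    rw [hmem] at hx ⊢
    intro k hk
    refine (h.isSymmetric_W (e k) x).symm.trans ?_
    change inner ℂ (h.W (e k)) x = 0
    rw [he.eigen k (hpos k hk), inner_smul_left, hx k hk, mul_zero]
  set T : Sᗮ →L[ℂ] Sᗮ := h.W.restrict hinv
  have hTapp : ∀ x : Sᗮ, ((T x : Sᗮ) : H) = h.W x := fun x => rfl
  have hT : ‖T‖ ≤ lam d := by
    refine norm_le_of_forall_eigenvalue_le (h.isCompactOperator_W.restrict' hinv)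
      (h.isSymmetric_W.restrict_invariant hinv) (fun x => ?_) (he.nonneg d) fun t x ht hx hTx => ?_
    · rw [Submodule.coe_inner, hTapp, h.inner_W', inner_self_eq_norm_sq_to_K]
      change 0 ≤ (((‖h.Id x‖ : ℝ) : ℂ) ^ 2).re
      rw [← Complex.ofReal_pow, Complex.ofReal_re]
      positivity
    -- An eigenvector for `t > lam d` lies in the span of the `e j` with `lam j = t`. Monotonicity
    -- forces `j < d`, so it lies in `S` as well as in its complement.
    · by_contra! hlt
      have hx' : h.W (x : H) = (t : ℂ) • (x : H) := by rw [← hTapp, hTx]; rfl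
      have hspan := he.exhaustive t x ht hx'
      have hS : (x : H) ∈ S := by
        refine Submodule.span_mono (Set.image_mono fun j hj => ?_) hspan
        by_contra hjd
        have h1 := he.antitone (not_lt.1 hjd)
        rw [Set.mem_ofPred_eq] at hj
        linarith
      have h0 := Submodule.inner_right_of_mem_orthogonal hS x.2
      exact hx (Subtype.ext (inner_self_eq_zero.1 h0))
  have hgK : g ∈ Sᗮ := (hmem g).2 hg
  have h1 : ‖h.Id g‖ ^ 2 = (inner ℂ g (h.W g)).re := by
    rw [h.inner_W', inner_self_eq_norm_sq_to_K]
    norm_cast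
  have h2 : ‖h.W g‖ ≤ lam d * ‖g‖ := by
    have := T.le_of_opNorm_le hT ⟨g, hgK⟩
    exact this
  calc ‖h.Id g‖ ^ 2 ≤ ‖inner ℂ g (h.W g)‖ := h1.trans_le (Complex.re_le_norm _)
    _ ≤ ‖g‖ * ‖h.W g‖ := norm_inner_le_norm _ _
    _ ≤ ‖g‖ * (lam d * ‖g‖) := by gcongr
    _ = _ := by ring

theorem IsEigensystem.inner_e (he : IsEigensystem h.W lam e) {j k : ℕ} (hj : 0 < lam j)
    (hk : 0 < lam k) : inner ℂ (e j) (e k) = if j = k then 1 else 0 := by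
  have := orthonormal_iff_ite.1 he.orthonormal ⟨j, hj⟩ ⟨k, hk⟩
  simpa using this

theorem IsEigensystem.inner_Id_eta (he : IsEigensystem h.W lam e) {j : ℕ} (hj : 0 < lam j)
    (g : H) : inner ℂ (h.Id (eta lam e j)) (h.Id g) = (√(lam j) : ℂ) * inner ℂ (e j) g := by
  rw [← h.inner_W, eta, map_smul, he.eigen j hj, inner_smul_left, inner_smul_left, Complex.conj_ofReal,
    Complex.conj_ofReal, ← mul_assoc, ← Complex.ofReal_mul]
  congr 2
  rw [inv_mul_eq_div, Real.div_sqrt]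

theorem IsEigensystem.inner_Id_eta_eta (he : IsEigensystem h.W lam e) {j k : ℕ} (hj : 0 < lam j)
    (hk : 0 < lam k) :
    inner ℂ (h.Id (eta lam e j)) (h.Id (eta lam e k)) = if j = k then 1 else 0 := by
  rw [he.inner_Id_eta hj, eta, inner_smul_right, he.inner_e hj hk]
  split_ifs with hjk
  · subst hjk
    have : (√(lam j) : ℂ) ≠ 0 := by exact_mod_cast (Real.sqrt_pos.2 hj).ne'
    push_cast
    field_simp
  · simp

end Embedding

section LeastSquares

variable {D : Type*} {H : Type*} [NormedAddCommGroup H] [InnerProductSpace ℂ H] [RKHS ℂ H D ℂ]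
variable (lam : ℕ → ℝ) (e : ℕ → H)

/-- The coefficients of the spectral projection with respect to the functions `η_k`. -/
noncomputable def projCoeff (m : ℕ) (f : H) (k : Fin (m - 1)) : ℂ := (√(lam k) : ℂ) * inner ℂ (e k) f

/-- The part of `f` that is not captured by the first `m - 1` eigenfunctions. -/
noncomputable def residual (m : ℕ) (f : H) : H := f - ∑ k, projCoeff lam e m f k • eta lam e k

variable {lam e}

theorem coe_eq_mulVec_add_residual (m : ℕ) {n : ℕ} (X : Fin n → D) (f : H) :
    (fun i => f (X i)) = sampleMatrix lam e m X *ᵥ projCoeff lam e m f +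
      fun i => residual lam e m f (X i) := by
  ext i
  have hsum : ∀ c : Fin (m - 1) → ℂ, (∑ k, c k • eta lam e k : H) (X i) =
      ∑ k, c k * eta lam e k (X i) := fun c => by
    change (RKHS.coeCLM ℂ : H →L[ℂ] D → ℂ) (∑ k, c k • eta lam e k) (X i) = _
    rw [map_sum, Finset.sum_apply]
    simp
  rw [Pi.add_apply, residual, RKHS.coe_sub, Pi.sub_apply, hsum]
  simp [mulVec, dotProduct, sampleMatrix, mul_comm]

/-- Least squares with full column rank reproduces every combination of the η_k, so the projection
of `f` cancels. -/
theorem sub_lsqApprox_eq {m n : ℕ} {X : Fin n → D}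
    (hdet : IsUnit ((sampleMatrix lam e m X)ᴴ * sampleMatrix lam e m X).det) (f : H) :
    f - lsqApprox lam e m X f = residual lam e m f - lsqApprox lam e m X (residual lam e m f) := by
  have hc : lsqCoeff lam e m X f = projCoeff lam e m f +
      lsqCoeff lam e m X (residual lam e m f) := by
    unfold lsqCoeff
    rw [coe_eq_mulVec_add_residual m X f, mulVec_add, mulVec_mulVec, Matrix.mul_assoc,
      nonsing_inv_mul _ hdet, one_mulVec]
  simp only [lsqApprox, hc, Pi.add_apply, add_smul, Finset.sum_add_distrib]
  rw [residual]
  abel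

/-- The complex conjugates of the functions `η_1, …, η_{m-1}`, as a vector field. -/
noncomputable def featureVec (lam : ℕ → ℝ) (e : ℕ → H) (m : ℕ) (x : D) (k : Fin (m - 1)) : ℂ :=
  star (eta lam e k x)

/-- The conjugation in `featureVec` is what makes the summands of the form `v v*`. -/
theorem conjTranspose_mul_sampleMatrix (m : ℕ) {n : ℕ} (X : Fin n → D) :
    (sampleMatrix lam e m X)ᴴ * sampleMatrix lam e m X =
      frameSum fun i => featureVec lam e m (X i) := by
  ext k l
  simp [frameSum, Matrix.mul_apply, Matrix.sum_apply, outer, vecMulVec_apply, sampleMatrix,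
    featureVec]

theorem gramMatrix_eq (m : ℕ) {n : ℕ} (X : Fin n → D) :
    gramMatrix lam e m X = (1 / n : ℂ) • frameSum fun i => featureVec lam e m (X i) := by
  rw [gramMatrix, conjTranspose_mul_sampleMatrix]

end LeastSquares

section Perturbation

variable {ι : Type*} [Fintype ι] [DecidableEq ι]

/-- The triangle inequality gives `‖b‖ ≤ ‖G b‖ + ‖b‖/2`. -/
theorem norm_le_two_mul_norm_mulVec {G : Matrix ι ι ℂ}
    (hG : ‖toEuclideanCLM (n := ι) (𝕜 := ℂ) (G - 1)‖ ≤ 1 / 2) (b : ι → ℂ) :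
    ‖WithLp.toLp 2 b‖ ≤ 2 * ‖WithLp.toLp 2 (G *ᵥ b)‖ := by
  have h1 := ContinuousLinearMap.le_of_opNorm_le _ hG (WithLp.toLp 2 b)
  rw [toEuclideanCLM_toLp, sub_mulVec, one_mulVec, WithLp.toLp_sub] at h1
  have h2 := norm_sub_norm_le (WithLp.toLp 2 b) (WithLp.toLp 2 (G *ᵥ b))
  rw [norm_sub_rev] at h2
  linarith

theorem isUnit_det_of_norm_sub_one_le {G : Matrix ι ι ℂ}
    (hG : ‖toEuclideanCLM (n := ι) (𝕜 := ℂ) (G - 1)‖ ≤ 1 / 2) : IsUnit G.det := by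
  rw [isUnit_iff_ne_zero]
  intro h0
  obtain ⟨b, hb, hGb⟩ := exists_mulVec_eq_zero_iff.2 h0
  have h1 := norm_le_two_mul_norm_mulVec hG b
  rw [hGb] at h1
  refine hb ?_
  have : WithLp.toLp 2 b = 0 := norm_le_zero_iff.1 (by simpa using h1)
  simpa using this

end Perturbation

section Error

variable {D : Type*} [MeasurableSpace D] {ρ : Measure D}
variable {H : Type*} [NormedAddCommGroup H] [InnerProductSpace ℂ H] [CompleteSpace H]
  [RKHS ℂ H D ℂ]
variable {h : CompactlyEmbedded ρ H} {lam : ℕ → ℝ} {e : ℕ → H}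

theorem IsEigensystem.inner_e_residual (he : IsEigensystem h.W lam e) {m : ℕ}
    (hpos : ∀ k < m - 1, 0 < lam k) (f : H) {k : ℕ} (hk : k < m - 1) :
    inner ℂ (e k) (residual lam e m f) = 0 := by
  have hterm : ∀ j : Fin (m - 1), projCoeff lam e m f j • eta lam e j =
      inner ℂ (e j) f • e j := fun j => by
    have : (√(lam j) : ℂ) ≠ 0 := by exact_mod_cast (Real.sqrt_pos.2 (hpos j j.2)).ne'
    rw [projCoeff, eta, smul_smul]
    congr 1
    push_cast
    field_simp
  rw [residual, inner_sub_right, inner_sum, Finset.sum_eq_single (⟨k, hk⟩ : Fin (m - 1))]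
  · rw [hterm, inner_smul_right, he.inner_e (hpos k hk) (hpos k hk)]
    simp
  · intro j _ hj
    rw [hterm, inner_smul_right, he.inner_e (hpos k hk) (hpos j j.2), if_neg, mul_zero]
    exact fun hkj => hj (Fin.ext hkj.symm)
  · simp

/-- The residual is orthogonal to the η_k in the Hilbert space `H` too, because they are multiples
of the `e k`. -/
theorem IsEigensystem.norm_residual_le (he : IsEigensystem h.W lam e) {m : ℕ}
    (hpos : ∀ k < m - 1, 0 < lam k) (f : H) : ‖residual lam e m f‖ ≤ ‖f‖ := by
  have h0 : inner ℂ (f - residual lam e m f) (residual lam e m f) = 0 := by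
    rw [residual, sub_sub_cancel, sum_inner]
    refine Finset.sum_eq_zero fun k _ => ?_
    rw [inner_smul_left, eta, inner_smul_left]
    have := he.inner_e_residual hpos f k.2
    rw [residual] at this
    rw [this]
    simp
  have h1 := norm_add_sq_eq_norm_sq_add_norm_sq_of_inner_eq_zero _ _ h0
  rw [sub_add_cancel] at h1
  nlinarith [norm_nonneg f, norm_nonneg (residual lam e m f),
    norm_nonneg (f - residual lam e m f)]

theorem IsEigensystem.norm_Id_residual_sq_le (he : IsEigensystem h.W lam e) {m : ℕ}
    (hpos : ∀ k < m - 1, 0 < lam k) {f : H} (hf : ‖f‖ ≤ 1) :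
    ‖h.Id (residual lam e m f)‖ ^ 2 ≤ sigma lam m ^ 2 := by
  rw [sigma, Real.sq_sqrt (he.nonneg _)]
  refine (he.norm_Id_sq_le hpos fun k hk => he.inner_e_residual hpos f hk).trans ?_
  have h1 := (he.norm_residual_le hpos f).trans hf
  exact mul_le_of_le_one_right (he.nonneg _) (pow_le_one₀ (norm_nonneg _) h1)

/-- Pythagoras for an element orthogonal to the eigenfunctions. -/
theorem IsEigensystem.norm_Id_residual_sub_sq (he : IsEigensystem h.W lam e) {m : ℕ}
    (hpos : ∀ k < m - 1, 0 < lam k) (f : H) (c : Fin (m - 1) → ℂ) :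
    ‖h.Id (residual lam e m f - ∑ k, c k • eta lam e k)‖ ^ 2 =
      ‖h.Id (residual lam e m f)‖ ^ 2 + ∑ k, ‖c k‖ ^ 2 := by
  have horth : Orthonormal ℂ fun k : Fin (m - 1) => h.Id (eta lam e k) := by
    rw [orthonormal_iff_ite]
    intro j k
    rw [he.inner_Id_eta_eta (hpos j j.2) (hpos k k.2)]
    simp [Fin.ext_iff]
  have h0 : inner ℂ (h.Id (residual lam e m f)) (-∑ k, c k • h.Id (eta lam e k)) = 0 := by
    rw [inner_neg_right, inner_sum, neg_eq_zero]
    refine Finset.sum_eq_zero fun k _ => ?_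
    rw [inner_smul_right, ← inner_conj_symm, he.inner_Id_eta (hpos k k.2),
      he.inner_e_residual hpos f k.2]
    simp
  have h1 := norm_add_sq_eq_norm_sq_add_norm_sq_of_inner_eq_zero _ _ h0
  simp only [map_sub, map_sum, map_smul]
  rw [sub_eq_add_neg, sq, h1, norm_neg]
  congr 1
  · rw [sq]
  · have h2 := horth.inner_sum c c Finset.univ
    rw [inner_self_eq_norm_sq_to_K] at h2
    have h3 : ((‖∑ k, c k • h.Id (eta lam e k)‖ ^ 2 : ℝ) : ℂ) = ((∑ k, ‖c k‖ ^ 2 : ℝ) : ℂ) := by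
      push_cast
      simpa [Complex.conj_mul'] using h2
    rw [← sq]
    exact_mod_cast h3

/-- On the good event the squared error is controlled by the empirical correlation of the
residual with the eigenfunctions. -/
theorem IsEigensystem.sqError_le (he : IsEigensystem h.W lam e) {m n : ℕ}
    (hpos : ∀ k < m - 1, 0 < lam k) (hn : 0 < n) {X : Fin n → D} (hX : X ∈ goodEvent lam e m n)
    (f : H) :
    sqError lam e h m X f ≤ ‖h.Id (residual lam e m f)‖ ^ 2 +
      4 / n ^ 2 * ∑ k : Fin (m - 1), ‖∑ i, star (eta lam e k (X i)) * residual lam e m f (X i)‖ ^ 2 := by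
  set g := residual lam e m f
  have hn' : (n : ℂ) ≠ 0 := by exact_mod_cast hn.ne'
  have hG : ‖toEuclideanCLM (n := Fin (m - 1)) (𝕜 := ℂ) (gramMatrix lam e m X - 1)‖ ≤ 1 / 2 := hX
  set A := sampleMatrix lam e m X with hA
  have hdet : IsUnit (Aᴴ * A).det := by
    have h1 := isUnit_det_of_norm_sub_one_le hG
    rw [gramMatrix, det_smul, isUnit_iff_ne_zero] at h1
    exact isUnit_iff_ne_zero.2 (right_ne_zero_of_mul h1)
  rw [sqError, sub_lsqApprox_eq hdet, lsqApprox, he.norm_Id_residual_sub_sq hpos]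
  gcongr
  set b := lsqCoeff lam e m X g
  set y : Fin (m - 1) → ℂ := Aᴴ *ᵥ fun i => g (X i) with hy
  -- The normal equations, divided by `n`.
  have hGb : gramMatrix lam e m X *ᵥ b = (1 / n : ℂ) • y := by
    rw [gramMatrix, smul_mulVec, hy]
    congr 1
    change (Aᴴ * A) *ᵥ (((Aᴴ * A)⁻¹ * Aᴴ) *ᵥ fun i => g (X i)) = _
    rw [mulVec_mulVec, ← Matrix.mul_assoc, mul_nonsing_inv _ hdet, Matrix.one_mul]
  have hb := norm_le_two_mul_norm_mulVec hG b
  rw [hGb, WithLp.toLp_smul, norm_smul] at hb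
  have hb2 : ‖WithLp.toLp 2 b‖ ^ 2 ≤ 4 / n ^ 2 * ‖WithLp.toLp 2 y‖ ^ 2 := by
    calc ‖WithLp.toLp 2 b‖ ^ 2 ≤ (2 * (‖(1 / n : ℂ)‖ * ‖WithLp.toLp 2 y‖)) ^ 2 := by gcongr
      _ = _ := by
        rw [norm_div, norm_one, Complex.norm_natCast]
        ring
  rw [EuclideanSpace.norm_sq_eq, EuclideanSpace.norm_sq_eq] at hb2
  exact hb2

end Error

end LSRecovery

/-! ### Second moments of sums of independent centred variables. -/

section SecondMoment

variable {D : Type*} [MeasurableSpace D] {ρ : Measure D} [IsProbabilityMeasure ρ]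

theorem memLp_sum_comp_eval {E : Type*} [NormedAddCommGroup E] {u : D → E} (hu : MemLp u 2 ρ)
    (n : ℕ) : MemLp (fun X : Fin n → D => ∑ i, u (X i)) 2 (Measure.pi fun _ => ρ) :=
  memLp_finsetSum _ fun i _ => hu.comp_measurePreserving (measurePreserving_eval (fun _ => ρ) i)

theorem integral_sq_sum_of_integral_eq_zero {u : D → ℝ} (hu : MemLp u 2 ρ)
    (h0 : ∫ x, u x ∂ρ = 0) (n : ℕ) :
    ∫ X : Fin n → D, (∑ i, u (X i)) ^ 2 ∂(Measure.pi fun _ => ρ) = n * ∫ x, u x ^ 2 ∂ρ := by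
  have hmean : ∫ X : Fin n → D, ∑ i, u (X i) ∂(Measure.pi fun _ => ρ) = 0 := by
    rw [integral_finsetSum _ fun i _ => integrable_comp_eval (hu.integrable one_le_two)]
    refine Finset.sum_eq_zero fun i _ => ?_
    rw [integral_comp_eval (μ := fun _ : Fin n => ρ) hu.aestronglyMeasurable, h0]
  have hv := variance_sum_pi (μ := fun _ : Fin n => ρ) (X := fun _ => u) fun _ => hu
  have e : (∑ i, fun X : Fin n → D => u (X i)) = fun X => ∑ i, u (X i) := by
    ext X
    simp
  rw [e, variance_of_integral_eq_zero (memLp_sum_comp_eval hu n).aestronglyMeasurable.aemeasurable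
    hmean] at hv
  rw [hv, variance_of_integral_eq_zero hu.aestronglyMeasurable.aemeasurable h0]
  simp

theorem integral_norm_sq_sum_of_integral_eq_zero {u : D → ℂ} (hu : MemLp u 2 ρ)
    (h0 : ∫ x, u x ∂ρ = 0) (n : ℕ) :
    ∫ X : Fin n → D, ‖∑ i, u (X i)‖ ^ 2 ∂(Measure.pi fun _ => ρ) = n * ∫ x, ‖u x‖ ^ 2 ∂ρ := by
  have hint := hu.integrable one_le_two
  have hre0 : ∫ x, (u x).re ∂ρ = 0 := by
    have := integral_re hint
    rw [h0] at this
    simpa using this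
  have him0 : ∫ x, (u x).im ∂ρ = 0 := by
    have := integral_im hint
    rw [h0] at this
    simpa using this
  have hsq : ∀ z : ℂ, ‖z‖ ^ 2 = z.re ^ 2 + z.im ^ 2 := fun z => by
    rw [Complex.sq_norm, Complex.normSq_apply]; ring
  have hre : MemLp (fun x => (u x).re) 2 ρ := hu.re
  have him : MemLp (fun x => (u x).im) 2 ρ := hu.im
  simp only [hsq, Complex.re_sum, Complex.im_sum]
  rw [integral_add (memLp_sum_comp_eval hre n).integrable_sq
    (memLp_sum_comp_eval him n).integrable_sq, integral_add hre.integrable_sq him.integrable_sq,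
    integral_sq_sum_of_integral_eq_zero hre hre0, integral_sq_sum_of_integral_eq_zero him him0]
  ring

end SecondMoment

theorem Matrix.rank_eq_card_iff_det_ne_zero {ι : Type*} [Fintype ι] [DecidableEq ι]
    (M : Matrix ι ι ℂ) : M.rank = Fintype.card ι ↔ M.det ≠ 0 := by
  refine ⟨fun h h0 => ?_, fun h =>
    Matrix.rank_of_isUnit M ((Matrix.isUnit_iff_isUnit_det M).2 (isUnit_iff_ne_zero.2 h))⟩
  obtain ⟨b, hb, hMb⟩ := Matrix.exists_mulVec_eq_zero_iff.2 h0
  have hrange : LinearMap.range M.mulVecLin = ⊤ := by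
    refine Submodule.eq_top_of_finrank_eq ?_
    rw [Module.finrank_fintype_fun_eq_card]
    exact h
  have hinj := LinearMap.injective_iff_surjective.2 (LinearMap.range_eq_top.1 hrange)
  exact hb (hinj (by simpa using hMb))

/-! ### Measurability, the mean error on the good event, and Markov's inequality. -/

namespace LSRecovery

open Matrix
open scoped ComplexOrder

variable {D : Type*} [MeasurableSpace D] {ρ : Measure D} [IsProbabilityMeasure ρ]
variable {H : Type*} [NormedAddCommGroup H] [InnerProductSpace ℂ H] [CompleteSpace H]
  [RKHS ℂ H D ℂ]
variable {h : CompactlyEmbedded ρ H} {lam : ℕ → ℝ} {e : ℕ → H}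

omit [CompleteSpace H] [MeasurableSpace D] in
theorem sum_norm_eta_sq_le {m : ℕ} {N : ℝ} (hN : 0 ≤ N)
    (hs : spectralFun (D := D) lam e m ≤ ENNReal.ofReal N) (x : D) :
    ∑ k : Fin (m - 1), ‖eta lam e k x‖ ^ 2 ≤ N := by
  have h1 := (le_iSup (fun x : D => ∑ k ∈ Finset.range (m - 1),
    ENNReal.ofReal (‖eta lam e k x‖ ^ 2)) x).trans hs
  rw [← ENNReal.ofReal_sum_of_nonneg fun k _ => by positivity, ENNReal.ofReal_le_ofReal_iff hN] at h1
  rwa [Fin.sum_univ_eq_sum_range (fun k => ‖eta lam e k x‖ ^ 2)]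

omit [CompleteSpace H] [IsProbabilityMeasure ρ] in
theorem aemeasurable_featureVec (h : CompactlyEmbedded ρ H) (m : ℕ) :
    AEMeasurable (featureVec (D := D) lam e m) ρ :=
  aemeasurable_pi_lambda _ fun k =>
    (continuous_star.comp_aestronglyMeasurable (h.memLp (eta lam e k)).aestronglyMeasurable).aemeasurable

omit [IsProbabilityMeasure ρ] in
theorem IsEigensystem.isBoundedIsotropic (he : IsEigensystem h.W lam e) {m : ℕ}
    (hpos : ∀ k < m - 1, 0 < lam k) {N : ℝ} (hN : 0 ≤ N)
    (hs : spectralFun (D := D) lam e m ≤ ENNReal.ofReal N) :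
    IsBoundedIsotropic ρ (featureVec (D := D) lam e m) N where
  aemeasurable := aemeasurable_featureVec h m
  bound x := by simpa [featureVec] using sum_norm_eta_sq_le hN hs x
  isotropic j k := by
    have h1 := he.inner_Id_eta_eta (hpos j j.2) (hpos k k.2)
    rw [h.inner_Id] at h1
    simp only [Fin.val_inj] at h1
    rw [← h1]
    refine integral_congr_ae (ae_of_all _ fun x => ?_)
    simp [featureVec, mul_comm]

/-- Taking traces in `E v v* = 1` gives `card ι = E ‖v‖²`. -/
theorem _root_.IsBoundedIsotropic.card_le {ι : Type*} [Fintype ι] [DecidableEq ι] {v : D → ι → ℂ}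
    {N : ℝ} (hv : IsBoundedIsotropic ρ v N) : (Fintype.card ι : ℝ) ≤ N := by
  have h1 := hv.integral_quadForm 1
  simp only [quadForm_one, trace_one, Complex.natCast_re] at h1
  have hint : Integrable (fun x => ∑ i, ‖v x i‖ ^ 2) ρ :=
    integrable_comp_of_bounded hv.aemeasurable hv.norm_le
      (F := fun w : ι → ℂ => ∑ i, ‖w i‖ ^ 2) (by fun_prop)
  rw [← h1]
  refine (integral_mono hint (integrable_const N) hv.bound).trans ?_
  simp

theorem aemeasurable_comp_eval {β : Type*} [MeasurableSpace β] {w : D → β} (hw : AEMeasurable w ρ)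
    {n : ℕ} (i : Fin n) : AEMeasurable (fun X : Fin n → D => w (X i)) (nodeLaw ρ n) := by
  unfold nodeLaw
  exact hw.comp_quasiMeasurePreserving (Measure.quasiMeasurePreserving_eval (fun _ => ρ) i)

omit [CompleteSpace H] in
theorem nullMeasurableSet_goodEvent (h : CompactlyEmbedded ρ H) (m n : ℕ) :
    NullMeasurableSet (goodEvent lam e m n) (nodeLaw ρ n) := by
  have hc : Continuous fun V : Fin n → Fin (m - 1) → ℂ =>
      ‖toEuclideanCLM (n := Fin (m - 1)) (𝕜 := ℂ) ((1 / n : ℂ) • frameSum V - 1)‖ := by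
    have hlin : Continuous fun A : Matrix (Fin (m - 1)) (Fin (m - 1)) ℂ =>
        toEuclideanCLM (n := Fin (m - 1)) (𝕜 := ℂ) A :=
      LinearMap.continuous_of_finiteDimensional
        (toEuclideanCLM (n := Fin (m - 1)) (𝕜 := ℂ)).toAlgEquiv.toLinearMap
    have hS : Continuous fun V : Fin n → Fin (m - 1) → ℂ => (1 / n : ℂ) • frameSum V - 1 :=
      ((continuous_frameSum (ι := Fin (m - 1)) (k := n)).const_smul (1 / n : ℂ)).sub
        (continuous_const (y := (1 : Matrix (Fin (m - 1)) (Fin (m - 1)) ℂ)))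
    have hcomp := hlin.comp hS
    exact continuous_norm.comp hcomp
  have hm : AEMeasurable (fun (X : Fin n → D) i => featureVec lam e m (X i)) (nodeLaw ρ n) :=
    aemeasurable_pi_lambda _ fun i => aemeasurable_comp_eval (aemeasurable_featureVec h m) i
  have h1 := nullMeasurableSet_le (hc.measurable.comp_aemeasurable hm)
    (aemeasurable_const (b := (1 / 2 : ℝ)))
  simpa only [goodEvent, gramMatrix_eq, Function.comp_def] using h1

omit [CompleteSpace H] in
theorem aemeasurable_sample (h : CompactlyEmbedded ρ H) (m n : ℕ) (f : H) :
    AEMeasurable (fun X : Fin n → D =>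
      ((fun i k => eta lam e k (X i), fun i => f (X i)) :
        (Fin n → Fin (m - 1) → ℂ) × (Fin n → ℂ))) (nodeLaw ρ n) := by
  have hev : ∀ (g : H) (i : Fin n), AEMeasurable (fun X : Fin n → D => g (X i)) (nodeLaw ρ n) :=
    fun g i => aemeasurable_comp_eval (h.memLp g).aestronglyMeasurable.aemeasurable i
  exact AEMeasurable.prodMk
    (aemeasurable_pi_lambda _ fun i => aemeasurable_pi_lambda _ fun k => hev _ i)
    (aemeasurable_pi_lambda _ fun i => hev f i)

/-- The inverse is the adjugate divided by the determinant. It is not continuous at singular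
matrices, but it is measurable everywhere because `0⁻¹ = 0`. -/
theorem measurable_lsqSolve {κ ι : Type*} [Fintype κ] [Fintype ι] [DecidableEq ι] :
    Measurable fun z : (κ → ι → ℂ) × (κ → ℂ) =>
      (((Matrix.of z.1)ᴴ * Matrix.of z.1)⁻¹ * (Matrix.of z.1)ᴴ) *ᵥ z.2 := by
  have hA : Continuous fun z : (κ → ι → ℂ) × (κ → ℂ) => (Matrix.of z.1 : Matrix κ ι ℂ) :=
    continuous_fst
  have hM := hA.matrix_conjTranspose.matrix_mul hA
  have h1 : Measurable fun z : (κ → ι → ℂ) × (κ → ℂ) =>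
      (((Matrix.of z.1)ᴴ * Matrix.of z.1).det)⁻¹ := hM.matrix_det.measurable.inv
  have h2 : Measurable fun z : (κ → ι → ℂ) × (κ → ℂ) =>
      (((Matrix.of z.1)ᴴ * Matrix.of z.1).adjugate * (Matrix.of z.1)ᴴ) *ᵥ z.2 :=
    ((hM.matrix_adjugate.matrix_mul hA.matrix_conjTranspose).matrix_mulVec
      continuous_snd).measurable
  simp only [inv_def, Ring.inverse_eq_inv', Matrix.smul_mul, smul_mulVec]
  exact h1.smul h2

omit [CompleteSpace H] in
theorem aemeasurable_lsqCoeff (h : CompactlyEmbedded ρ H) (m n : ℕ) (f : H) :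
    AEMeasurable (fun X : Fin n → D => lsqCoeff lam e m X f) (nodeLaw ρ n) := by
  have h1 := (measurable_lsqSolve (κ := Fin n) (ι := Fin (m - 1))).comp_aemeasurable
    (aemeasurable_sample (lam := lam) (e := e) h m n f)
  simp only [Function.comp_def] at h1
  unfold lsqCoeff sampleMatrix
  exact h1

omit [CompleteSpace H] in
theorem aemeasurable_sqError (h : CompactlyEmbedded ρ H) (m n : ℕ) (f : H) :
    AEMeasurable (fun X : Fin n → D => sqError lam e h m X f) (nodeLaw ρ n) := by
  have hcoeff := aemeasurable_lsqCoeff (lam := lam) (e := e) h m n f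
  have hF : Continuous fun c : Fin (m - 1) → ℂ =>
      ‖h.Id (f - ∑ k : Fin (m - 1), c k • eta lam e k)‖ ^ 2 :=
    ((h.Id.continuous.comp (continuous_const.sub (continuous_finsetSum _ fun k _ =>
      (continuous_apply k).smul continuous_const))).norm).pow 2
  exact hF.measurable.comp_aemeasurable hcoeff

omit [CompleteSpace H] [MeasurableSpace D] in
theorem rank_conjTranspose_mul_sampleMatrix (m : ℕ) {n : ℕ} (X : Fin n → D) :
    ((sampleMatrix lam e m X)ᴴ * sampleMatrix lam e m X).rank = (sampleMatrix lam e m X).rank :=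
  rank_conjTranspose_mul_self _

omit [CompleteSpace H] in
theorem nullMeasurableSet_successEvent (h : CompactlyEmbedded ρ H) (m n : ℕ) (δ : ℝ) (f : H) :
    NullMeasurableSet (successEvent lam e h m n δ f) (nodeLaw ρ n) := by
  refine NullMeasurableSet.inter ?_
    (nullMeasurableSet_le (aemeasurable_sqError h m n f) aemeasurable_const)
  have hdet : Continuous fun z : Fin n → Fin (m - 1) → ℂ =>
      ((Matrix.of z)ᴴ * Matrix.of z).det := by
    have hA : Continuous fun z : Fin n → Fin (m - 1) → ℂ =>
        (Matrix.of z : Matrix (Fin n) (Fin (m - 1)) ℂ) := continuous_id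
    exact (hA.matrix_conjTranspose.matrix_mul hA).matrix_det
  have h1 : AEMeasurable (fun X : Fin n → D =>
      ((sampleMatrix lam e m X)ᴴ * sampleMatrix lam e m X).det) (nodeLaw ρ n) :=
    hdet.measurable.comp_aemeasurable (measurable_fst.comp_aemeasurable (aemeasurable_sample h m n f))
  have h2 := h1.nullMeasurable (measurableSet_singleton (0 : ℂ)).compl
  have e : {X : Fin n → D | (sampleMatrix lam e m X).rank = m - 1} =
      (fun X => ((sampleMatrix lam e m X)ᴴ * sampleMatrix lam e m X).det) ⁻¹' {0}ᶜ := by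
    ext X
    change _ = _ ↔ _ ≠ _
    rw [← rank_eq_card_iff_det_ne_zero, rank_conjTranspose_mul_sampleMatrix, Fintype.card_fin]
  rw [← e] at h2
  exact h2

/-- The expected squared norm of the empirical correlation of the residual with the
eigenfunctions. -/
theorem IsEigensystem.integral_correlation_le (he : IsEigensystem h.W lam e) {m : ℕ}
    (hpos : ∀ k < m - 1, 0 < lam k) {N : ℝ}
    (hb : ∀ x : D, ∑ k : Fin (m - 1), ‖eta lam e k x‖ ^ 2 ≤ N) (n : ℕ) (f : H) :
    Integrable (fun X : Fin n → D => ∑ k : Fin (m - 1),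
      ‖∑ i, star (eta lam e k (X i)) * residual lam e m f (X i)‖ ^ 2) (nodeLaw ρ n) ∧
    ∫ X : Fin n → D, ∑ k : Fin (m - 1),
      ‖∑ i, star (eta lam e k (X i)) * residual lam e m f (X i)‖ ^ 2 ∂(nodeLaw ρ n) ≤
      n * (N * ‖h.Id (residual lam e m f)‖ ^ 2) := by
  set g := residual lam e m f with hg
  have hgL := h.memLp g
  -- The bound `|η_k| ≤ √N` keeps the product with `g` square integrable.
  have hL : ∀ k : Fin (m - 1), MemLp (fun x => star (eta lam e k x) * g x) 2 ρ := fun k => by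
    refine hgL.of_le_mul (c := √N) ((continuous_star.comp_aestronglyMeasurable
      (h.memLp (eta lam e k)).aestronglyMeasurable).mul hgL.aestronglyMeasurable)
      (ae_of_all _ fun x => ?_)
    rw [norm_mul, norm_star]
    refine mul_le_mul_of_nonneg_right (Real.le_sqrt_of_sq_le ?_) (norm_nonneg _)
    exact (Finset.single_le_sum (f := fun k : Fin (m - 1) => ‖eta lam e k x‖ ^ 2)
      (fun k _ => by positivity) (Finset.mem_univ k)).trans (hb x)
  have h0 : ∀ k : Fin (m - 1), ∫ x, star (eta lam e k x) * g x ∂ρ = 0 := fun k => by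
    have h1 := h.inner_Id (eta lam e k) g
    rw [he.inner_Id_eta (hpos k k.2), he.inner_e_residual hpos f k.2, mul_zero] at h1
    rw [h1]
    exact integral_congr_ae (ae_of_all _ fun x => mul_comm _ _)
  have hint : ∀ k : Fin (m - 1), Integrable (fun X : Fin n → D =>
      ‖∑ i, star (eta lam e k (X i)) * g (X i)‖ ^ 2) (nodeLaw ρ n) := fun k =>
    (memLp_sum_comp_eval (hL k) n).norm.integrable_sq
  refine ⟨integrable_finsetSum _ fun k _ => hint k, ?_⟩
  rw [integral_finsetSum _ fun k _ => hint k]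
  have hk : ∀ k : Fin (m - 1), ∫ X : Fin n → D,
      ‖∑ i, star (eta lam e k (X i)) * g (X i)‖ ^ 2 ∂(nodeLaw ρ n) =
      n * ∫ x, ‖star (eta lam e k x) * g x‖ ^ 2 ∂ρ := fun k =>
    integral_norm_sq_sum_of_integral_eq_zero (hL k) (h0 k) n
  have hint' : ∀ k : Fin (m - 1), Integrable (fun x => ‖star (eta lam e k x) * g x‖ ^ 2) ρ :=
    fun k => (hL k).norm.integrable_sq
  simp only [hk]
  rw [← Finset.mul_sum, ← integral_finsetSum _ fun k _ => hint' k, h.norm_Id_sq,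
    ← integral_const_mul N]
  refine mul_le_mul_of_nonneg_left (integral_mono (integrable_finsetSum _ fun k _ => hint' k)
    (hgL.norm.integrable_sq.const_mul N) fun x => ?_) (Nat.cast_nonneg n)
  simp only [norm_mul, norm_star, mul_pow]
  rw [← Finset.sum_mul]
  exact mul_le_mul_of_nonneg_right (hb x) (by positivity)

instance {n : ℕ} : IsProbabilityMeasure (nodeLaw ρ n) := by
  unfold nodeLaw
  infer_instance

/-- The expected squared error on the good event. -/
theorem IsEigensystem.setIntegral_sqError_le (he : IsEigensystem h.W lam e) {m n : ℕ}
    (hpos : ∀ k < m - 1, 0 < lam k) (hn : 0 < n) {N : ℝ} (hN : 0 ≤ N)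
    (hb : ∀ x : D, ∑ k : Fin (m - 1), ‖eta lam e k x‖ ^ 2 ≤ N) {f : H} (hf : ‖f‖ ≤ 1) :
    IntegrableOn (fun X => sqError lam e h m X f) (goodEvent lam e m n) (nodeLaw ρ n) ∧
    ∫ X in goodEvent lam e m n, sqError lam e h m X f ∂(nodeLaw ρ n) ≤
      sigma lam m ^ 2 * (1 + 4 * (N / n)) := by
  have hn' : (0 : ℝ) < n := by exact_mod_cast hn
  obtain ⟨hci, hcle⟩ := he.integral_correlation_le hpos hb n f
  set G : (Fin n → D) → ℝ := fun X => ∑ k : Fin (m - 1),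
      ‖∑ i, star (eta lam e k (X i)) * residual lam e m f (X i)‖ ^ 2 with hG
  have hbi : Integrable (fun X => ‖h.Id (residual lam e m f)‖ ^ 2 + 4 / n ^ 2 * G X)
      (nodeLaw ρ n) := (integrable_const _).add (hci.const_mul _)
  have hmeas := nullMeasurableSet_goodEvent (lam := lam) (e := e) h m n
  have hle : ∀ᵐ X ∂((nodeLaw ρ n).restrict (goodEvent lam e m n)), sqError lam e h m X f ≤
      ‖h.Id (residual lam e m f)‖ ^ 2 + 4 / n ^ 2 * G X :=
    (ae_restrict_iff'₀ hmeas).2 (ae_of_all _ fun X hX => he.sqError_le hpos hn hX f)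
  have hint : IntegrableOn (fun X => sqError lam e h m X f) (goodEvent lam e m n)
      (nodeLaw ρ n) := by
    refine Integrable.mono' hbi.integrableOn
      (aemeasurable_sqError h m n f).aestronglyMeasurable.restrict ?_
    filter_upwards [hle] with X hX
    rwa [Real.norm_of_nonneg (by unfold sqError; positivity)]
  refine ⟨hint, ?_⟩
  calc ∫ X in goodEvent lam e m n, sqError lam e h m X f ∂(nodeLaw ρ n)
      ≤ ∫ X in goodEvent lam e m n, (‖h.Id (residual lam e m f)‖ ^ 2 + 4 / n ^ 2 * G X)
          ∂(nodeLaw ρ n) := integral_mono_ae hint hbi.integrableOn hle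
    -- The bound is nonnegative, so the event can be dropped before using the independence of the
    -- nodes.
    _ ≤ ∫ X, (‖h.Id (residual lam e m f)‖ ^ 2 + 4 / n ^ 2 * G X) ∂(nodeLaw ρ n) :=
        setIntegral_le_integral hbi (ae_of_all _ fun X => by
          have : 0 ≤ G X := Finset.sum_nonneg fun k _ => by positivity
          change 0 ≤ _
          positivity)
    _ = ‖h.Id (residual lam e m f)‖ ^ 2 + 4 / n ^ 2 * ∫ X, G X ∂(nodeLaw ρ n) := by
        rw [integral_add (integrable_const _) (hci.const_mul _), integral_const_mul]
        simp
    _ ≤ ‖h.Id (residual lam e m f)‖ ^ 2 +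
          4 / n ^ 2 * (n * (N * ‖h.Id (residual lam e m f)‖ ^ 2)) := by gcongr
    _ = ‖h.Id (residual lam e m f)‖ ^ 2 * (1 + 4 * (N / n)) := by field_simp
    _ ≤ _ := mul_le_mul_of_nonneg_right (he.norm_Id_residual_sq_le hpos hf) (by positivity)

theorem IsEigensystem.measureReal_compl_goodEvent_le (he : IsEigensystem h.W lam e) {m n : ℕ}
    (hpos : ∀ k < m - 1, 0 < lam k) (hn : 0 < n) {N : ℝ} (hN : 0 ≤ N)
    (hs : spectralFun (D := D) lam e m ≤ ENNReal.ofReal N) (p : ℕ) (hp : p * (N / n) ≤ 1 / 4) :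
    (nodeLaw ρ n).real (goodEvent lam e m n)ᶜ ≤ 2 * ((m - 1 : ℕ) : ℝ) * (6 / 7 : ℝ) ^ p := by
  have := (he.isBoundedIsotropic hpos hN hs).measureReal_norm_gt_le hN hn p hp
  rw [Fintype.card_fin] at this
  simpa only [goodEvent, gramMatrix_eq, nodeLaw] using this

/-- Markov's inequality on an event, for a possibly vanishing bound. -/
theorem _root_.MeasureTheory.measureReal_inter_lt_le {Ω : Type*} [MeasurableSpace Ω]
    {μ : Measure Ω} [IsFiniteMeasure μ] {s : Set Ω} (hs : NullMeasurableSet s μ) {F : Ω → ℝ}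
    (hF0 : ∀ ω, 0 ≤ F ω) (hF : IntegrableOn F s μ) {B δ : ℝ} (hδ : 0 < δ)
    (hB : ∫ ω in s, F ω ∂μ ≤ B) : μ.real (s ∩ {ω | 1 / δ * B < F ω}) ≤ δ := by
  have hr : μ.real (s ∩ {ω | 1 / δ * B < F ω}) = (μ.restrict s).real {ω | 1 / δ * B < F ω} := by
    rw [measureReal_def, measureReal_def, Measure.restrict_apply₀' hs, Set.inter_comm]
  rw [hr]
  -- The case `B = 0` does occur, as σ_m may vanish; then `F = 0` almost everywhere on `s`.
  rcases (le_trans (integral_nonneg hF0) hB).eq_or_lt with h0 | hBpos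
  · have hz : ∫ ω in s, F ω ∂μ = 0 := le_antisymm (hB.trans h0.symm.le) (integral_nonneg hF0)
    have hae := (integral_eq_zero_iff_of_nonneg hF0 hF).1 hz
    have : (μ.restrict s) {ω | 1 / δ * B < F ω} = 0 := by
      rw [← h0, mul_zero]
      refine measure_mono_null (fun ω hω => ?_) (ae_iff.1 hae)
      exact ne_of_gt hω
    rw [measureReal_def, this]
    simpa using hδ.le
  · have hm := mul_meas_ge_le_integral_of_nonneg (ae_of_all _ hF0) hF (1 / δ * B)
    have hmono : (μ.restrict s).real {ω | 1 / δ * B < F ω} ≤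
        (μ.restrict s).real {ω | 1 / δ * B ≤ F ω} :=
      measureReal_mono fun ω (hω : 1 / δ * B < F ω) => hω.le
    refine hmono.trans (le_of_mul_le_mul_left ((hm.trans hB).trans_eq ?_)
      (show 0 < 1 / δ * B by positivity))
    field_simp

end LSRecovery

/-! ### The choice of constants and the main theorem. -/

open LSRecovery in
theorem theorem6p1 :
    ∃ C : ℝ → ℝ, (∀ δ : ℝ, 0 < δ → δ < 1 → 0 < C δ ∧ C δ ≤ 0.06) ∧
      ∀ {D : Type*} [MeasurableSpace D] (ρ : Measure D) [IsProbabilityMeasure ρ]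
        {H : Type*} [NormedAddCommGroup H] [InnerProductSpace ℂ H] [CompleteSpace H]
        [RKHS ℂ H D ℂ] (hH : LSRecovery.CompactlyEmbedded ρ H)
        (lam : ℕ → ℝ) (e : ℕ → H) (_ : LSRecovery.IsEigensystem hH.W lam e)
        (m n : ℕ) (_ : 2 ≤ m)
        -- the functions `η_1, …, η_{m-1}` exist
        (_ : ∀ k < m - 1, 0 < lam k)
        (δ : ℝ) (_ : 0 < δ) (_ : δ < 1)
        (_ : LSRecovery.spectralFun (D := D) lam e m ≤
          ENNReal.ofReal (n / (48 * (Real.sqrt 2 * Real.log (2 * n) - Real.log δ))))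
        (f : H) (_ : ‖f‖ ≤ 1),
        -- the conditional expectation given the event `‖H_m - I_m‖ ≤ 1/2`
        (NullMeasurableSet (LSRecovery.goodEvent lam e m n) (LSRecovery.nodeLaw ρ n) ∧
          0 < LSRecovery.nodeLaw ρ n (LSRecovery.goodEvent lam e m n) ∧
          Integrable (fun X => LSRecovery.sqError lam e hH m X f)
            (ProbabilityTheory.cond (LSRecovery.nodeLaw ρ n) (LSRecovery.goodEvent lam e m n)) ∧
          ∫ X, LSRecovery.sqError lam e hH m X f
              ∂(ProbabilityTheory.cond (LSRecovery.nodeLaw ρ n) (LSRecovery.goodEvent lam e m n)) ≤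
            1 / (1 - δ) * (LSRecovery.sigma lam m ^ 2
              + C δ / Real.log n * LSRecovery.sigma lam m ^ 2) ∧
          1 / (1 - δ) * (LSRecovery.sigma lam m ^ 2
              + C δ / Real.log n * LSRecovery.sigma lam m ^ 2) ≤
            1.1 / (1 - δ) * LSRecovery.sigma lam m ^ 2) ∧
        -- the probability bound
        (NullMeasurableSet (LSRecovery.successEvent lam e hH m n δ f) (LSRecovery.nodeLaw ρ n) ∧
          1 - 3 * δ ≤ (LSRecovery.nodeLaw ρ n).real (LSRecovery.successEvent lam e hH m n δ f)) := by
  -- A constant function of δ suffices.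
  refine ⟨fun _ => 0.06, fun δ _ _ => ⟨by norm_num, le_rfl⟩, ?_⟩
  intro D _ ρ _ H _ _ _ _ hH lam e he m n hm hpos δ hδ hδ1 hs f hf
  set L := √2 * Real.log (2 * n) - Real.log δ with hL
  have hlogδ : Real.log δ < 0 := Real.log_neg hδ hδ1
  -- At this point `n = 0` is not excluded; the bound then holds because `Real.log 0 = 0`.
  have hlog2n : 0 ≤ Real.log (2 * n) := by
    have := Real.log_natCast_nonneg (2 * n)
    push_cast at this
    exact this
  have hLpos : 0 < L := by
    have : 0 ≤ √2 * Real.log (2 * n) := by positivity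
    linarith
  set N : ℝ := n / (48 * L) with hNdef
  have hN : 0 ≤ N := by positivity
  have hiso := he.isBoundedIsotropic hpos hN hs
  have hcard := hiso.card_le
  rw [Fintype.card_fin] at hcard
  have hd1 : (1 : ℝ) ≤ ((m - 1 : ℕ) : ℝ) := by exact_mod_cast (by omega : 1 ≤ m - 1)
  -- Since `m ≥ 2`, the dimension is at least one. This forces `n ≥ 48L`, hence `n ≥ 2` and a
  -- positive `log n`.
  have hN1 : 1 ≤ N := hd1.trans hcard
  have hnpos : 0 < n := by
    rcases Nat.eq_zero_or_pos n with h0 | h0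
    · rw [hNdef, h0] at hN1
      norm_num at hN1
    · exact h0
  have hn' : (0 : ℝ) < n := by exact_mod_cast hnpos
  have hn1 : (1 : ℝ) ≤ n := by exact_mod_cast hnpos
  have hsqrt : (1.4 : ℝ) ≤ √2 := Real.le_sqrt_of_sq_le (by norm_num)
  have hlog2 : Real.log 2 ≤ Real.log (2 * n) := Real.log_le_log (by norm_num) (by linarith)
  have hl2 := Real.log_two_gt_d9
  have hL5 : 1 / 5 ≤ L := by nlinarith
  have hNn : N / n = 1 / (48 * L) := by rw [hNdef]; field_simp
  have hn48 : 48 * L ≤ n := by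
    rw [hNdef, le_div_iff₀ (by positivity)] at hN1
    linarith
  have hn2 : (2 : ℝ) ≤ n := by linarith
  have hlogn : 0.6 ≤ Real.log n := by
    have := Real.log_le_log (by norm_num) hn2
    linarith
  have hNle : N ≤ n := by
    rw [hNdef]
    exact div_le_self hn'.le (by linarith)
  have hgoodc : (nodeLaw ρ n).real (goodEvent lam e m n)ᶜ ≤ δ := by
    -- The power `⌊12L⌋` is the largest natural number `p` with `p N/n ≤ 1/4`, because `N/n =
    -- 1/(48L)`.
    refine (he.measureReal_compl_goodEvent_le hpos hnpos hN hs ⌊12 * L⌋₊ ?_).trans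
      (exp_tail_bound (hcard.trans hNle) hn1 hδ hL hL5)
    rw [hNn]
    have := Nat.floor_le (show 0 ≤ 12 * L by positivity)
    rw [mul_one_div, div_le_iff₀ (by positivity)]
    linarith
  have hmeas := nullMeasurableSet_goodEvent (lam := lam) (e := e) hH m n
  have hgood : 1 - δ ≤ (nodeLaw ρ n).real (goodEvent lam e m n) := by
    have h1 := measureReal_union_le (μ := nodeLaw ρ n) (goodEvent lam e m n)
      (goodEvent lam e m n)ᶜ
    rw [Set.union_compl_self, probReal_univ] at h1
    linarith
  have hgpos : 0 < (nodeLaw ρ n).real (goodEvent lam e m n) := by linarith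
  have hb := sum_norm_eta_sq_le (lam := lam) (e := e) hN hs
  obtain ⟨hint, hile⟩ := he.setIntegral_sqError_le hpos hnpos hN hb hf
  have hsig : 0 ≤ sigma lam m ^ 2 := by positivity
  have hB : ∫ X in goodEvent lam e m n, sqError lam e hH m X f ∂(nodeLaw ρ n) ≤
      sigma lam m ^ 2 * (1 + 0.06 / Real.log n) := by
    refine hile.trans (mul_le_mul_of_nonneg_left ?_ hsig)
    rw [hNn]
    have hlogle : Real.log n ≤ Real.log (2 * n) := Real.log_le_log hn' (by linarith)
    -- The source of 0.06: `4N/n = 1/(12L) ≤ 1/(16.8 log n)`, and `1/16.8 < 0.06`.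
    have hLlog : 1.4 * Real.log n ≤ L := by nlinarith
    have : 4 * (1 / (48 * L)) ≤ 0.06 / Real.log n := by
      rw [mul_one_div, div_le_div_iff₀ (by positivity) (by linarith)]
      linarith
    linarith
  have hsq0 : ∀ X : Fin n → D, 0 ≤ sqError lam e hH m X f := fun X => by
    unfold sqError; positivity
  have hgm : nodeLaw ρ n (goodEvent lam e m n) ≠ 0 := fun h0 => by
    rw [measureReal_def, h0] at hgpos
    simp at hgpos
  refine ⟨⟨hmeas, pos_iff_ne_zero.2 hgm, hint.smul_measure (ENNReal.inv_ne_top.2 hgm), ?_, ?_⟩,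
    nullMeasurableSet_successEvent hH m n δ f, ?_⟩
  · rw [ProbabilityTheory.cond, integral_smul_measure, ENNReal.toReal_inv, smul_eq_mul]
    change ((nodeLaw ρ n).real (goodEvent lam e m n))⁻¹ * _ ≤ _
    have h1 : ((nodeLaw ρ n).real (goodEvent lam e m n))⁻¹ ≤ 1 / (1 - δ) := by
      rw [one_div]
      exact inv_anti₀ (by linarith) hgood
    refine (mul_le_mul h1 hB (integral_nonneg hsq0)
      (one_div_nonneg.2 (by linarith))).trans_eq ?_
    ring
  · have h1 : 0.06 / Real.log n ≤ 0.1 := by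
      rw [div_le_iff₀ (by linarith)]
      linarith
    have h2 : sigma lam m ^ 2 + 0.06 / Real.log n * sigma lam m ^ 2 ≤ 1.1 * sigma lam m ^ 2 := by
      have := mul_le_mul_of_nonneg_right h1 hsig
      linarith
    calc _ ≤ 1 / (1 - δ) * (1.1 * sigma lam m ^ 2) :=
          mul_le_mul_of_nonneg_left h2 (one_div_nonneg.2 (by linarith))
      _ = _ := by ring
  -- The good event fails with probability at most δ, and Markov's inequality on it loses another δ,
  -- so even `1 - 2δ` is reached.
  · have hmk := measureReal_inter_lt_le hmeas hsq0 hint hδ hB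
    have hcover : (Set.univ : Set (Fin n → D)) ⊆ successEvent lam e hH m n δ f ∪
        ((goodEvent lam e m n)ᶜ ∪ (goodEvent lam e m n ∩ {X | 1 / δ *
          (sigma lam m ^ 2 * (1 + 0.06 / Real.log n)) < sqError lam e hH m X f})) := by
      intro X _
      by_cases hX : X ∈ goodEvent lam e m n
      · by_cases hX2 : 1 / δ * (sigma lam m ^ 2 * (1 + 0.06 / Real.log n)) <
            sqError lam e hH m X f
        · exact Or.inr (Or.inr ⟨hX, hX2⟩)
        · refine Or.inl ⟨?_, ?_⟩
          · have hdet := isUnit_det_of_norm_sub_one_le (ι := Fin (m - 1)) hX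
            rw [gramMatrix, Matrix.det_smul, isUnit_iff_ne_zero] at hdet
            rw [← rank_conjTranspose_mul_sampleMatrix]
            exact ((Matrix.rank_eq_card_iff_det_ne_zero _).2 (right_ne_zero_of_mul hdet)).trans
              (Fintype.card_fin _)
          · rw [mul_assoc]
            exact not_lt.1 hX2
      · exact Or.inr (Or.inl hX)
    have h1 := measureReal_mono (μ := nodeLaw ρ n) hcover
    rw [probReal_univ] at h1
    have h2 := h1.trans (measureReal_union_le _ _)
    have h3 := measureReal_union_le (μ := nodeLaw ρ n) (goodEvent lam e m n)ᶜ
      (goodEvent lam e m n ∩ {X | 1 / δ *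
          (sigma lam m ^ 2 * (1 + 0.06 / Real.log n)) < sqError lam e hH m X f})
    linarith
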